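/- Let $r\ge 1$ and let $A,R,S$ be real $r\times r$ matrices with $R,S$ symmetric positive semi-definite, and let $R^{1/2},S^{1/2}$ be symmetric square roots of $R,S$. Assume that the pairs $(A,R^{1/2})$ and $(A',S^{1/2})$ are controllable, i.e. the block matrices $[R^{1/2},AR^{1/2},\ldots,A^{r-1}R^{1/2}]$ and $[S^{1/2},A'S^{1/2},\ldots,(A')^{r-1}S^{1/2}]$ have rank $r$ (a prime denotes transposition). Put $\mathrm{Ricc}(P):=AP+PA'+R-PSP$, let $\|\cdot\|$ be the spectral norm, and let $\lambda_{\min}$ denote the minimal eigenvalue of a symmetric matrix. Then there are a unique positive definite matrix $P_\infty$ and a unique negative definite matrix $P_\infty^-$ with $\mathrm{Ricc}(P_\infty)=0=\mathrm{Ricc}(P_\infty^-)$; the Riccati equation $\partial_t\phi_t(Q)=\mathrm{Ricc}(\phi_t(Q))$, $\phi_0(Q)=Q$, has a solution on $[0,\infty)$ for every symmetric positive semi-definite $Q$; and there are $\alpha,\beta>0$ such that $$\|e^{t(A-P_\infty S)}\|\le \alpha e^{-\beta t}\qquad\text{for all } t\ge 0.\qquad(*)$$ For $\delta>0$ and $P$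 symmetric positive semi-definite set $$\Delta_\delta:=\int_0^\delta e^{s(A-P_\infty S)'}\,S\,e^{s(A-P_\infty S)}\,ds,\qquad \chi_\delta:=\big[\lambda_{\min}(\Delta_\delta)\,\lambda_{\min}(-P_\infty^-)\big]^{-1},$$ $$\chi(P):=\|(P_\infty^-)^{-1}\|\,\big[\|P_\infty-P_\infty^-\|+\|P-P_\infty\|\big].$$ For all $\alpha,\beta>0$ satisfying $(*)$ and all symmetric positive semi-definite $Q_1,Q_2$ the following holds. For all $t\ge\delta>0$, $$\|\phi_t(Q_1)-\phi_t(Q_2)\|\le(\alpha\chi_\delta)^2\,e^{-2\beta t}\,\|Q_1-Q_2\|,$$ and for all $t\ge 0$, $$\|\phi_t(Q_1)-\phi_t(Q_2)\|\le\alpha^2\,\chi(Q_1)\,\chi(Q_2)\,e^{-2\beta t}\,\|Q_1-Q_2\|.$$ -/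

import Mathlib

-- `‖M‖` is the spectral norm (the operator norm for Euclidean norms) of a matrix.
open scoped Matrix Matrix.Norms.L2Operator

noncomputable section

namespace Riccati

variable {r : ℕ}

/-- The Kalman rank condition: the `r × r²` block matrix `[B, AB, …, A^{r-1}B]` has rank `r`.
Its columns are indexed by pairs (exponent, column of `B`). -/
def IsControllable (A B : Matrix (Fin r) (Fin r) ℝ) : Prop :=
  (Matrix.of fun (i : Fin r) (k : Fin r × Fin r) => (A ^ (k.1 : ℕ) * B) i k.2).rank = r

/-- The Riccati drift `Ricc(P) = AP + PA' + R - PSP`. -/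
def ricc (A R S P : Matrix (Fin r) (Fin r) ℝ) : Matrix (Fin r) (Fin r) ℝ :=
  A * P + P * Aᵀ + R - P * S * P

/-- `φ` is the evolution semigroup of the Riccati equation on positive semi-definite initial
conditions: `∂ₜ φₜ(Q) = Ricc(φₜ(Q))` for all `t ≥ 0` (one-sided at `0`) and `φ₀(Q) = Q`. -/
def IsRiccatiFlow (A R S : Matrix (Fin r) (Fin r) ℝ)
    (φ : ℝ → Matrix (Fin r) (Fin r) ℝ → Matrix (Fin r) (Fin r) ℝ) : Prop :=
  ∀ Q : Matrix (Fin r) (Fin r) ℝ, Q.PosSemidef →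
    φ 0 Q = Q ∧
    ∀ t : ℝ, 0 ≤ t →
      HasDerivWithinAt (fun s => φ s Q) (ricc A R S (φ t Q)) (Set.Ici 0) t

/-- A positive definite fixed point of the algebraic Riccati equation. -/
def IsPosFixedPoint (A R S P : Matrix (Fin r) (Fin r) ℝ) : Prop :=
  P.PosDef ∧ ricc A R S P = 0

/-- A negative definite fixed point of the algebraic Riccati equation. -/
def IsNegFixedPoint (A R S P : Matrix (Fin r) (Fin r) ℝ) : Prop :=
  (-P).PosDef ∧ ricc A R S P = 0

/-- The semigroup `Eₜ(P∞) = exp(t (A - P∞ S))`. -/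
def expSemigroup (A S Pinf : Matrix (Fin r) (Fin r) ℝ) (t : ℝ) : Matrix (Fin r) (Fin r) ℝ :=
  NormedSpace.exp (t • (A - Pinf * S))

/-- `‖Eₜ(P∞)‖ ≤ α e^{-βt}` for all `t ≥ 0`. -/
def IsDecayPair (A S Pinf : Matrix (Fin r) (Fin r) ℝ) (α β : ℝ) : Prop :=
  0 < α ∧ 0 < β ∧ ∀ t : ℝ, 0 ≤ t → ‖expSemigroup A S Pinf t‖ ≤ α * Real.exp (-β * t)

/-- The Gramian `Δₜ = ∫₀ᵗ e^{s(A - P∞S)'} S e^{s(A - P∞S)} ds`. -/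
def gramian (A S Pinf : Matrix (Fin r) (Fin r) ℝ) (t : ℝ) : Matrix (Fin r) (Fin r) ℝ :=
  ∫ s in (0 : ℝ)..t, (expSemigroup A S Pinf s)ᵀ * S * expSemigroup A S Pinf s

/-- The minimal eigenvalue of a real symmetric matrix (of positive size). -/
def lambdaMin (M : Matrix (Fin r) (Fin r) ℝ) : ℝ :=
  sInf (spectrum ℝ M)

/-- `χ(P) = ‖(P∞⁻)⁻¹‖ (‖P∞ - P∞⁻‖ + ‖P - P∞‖)`. -/
def chi (Pinf Pneg P : Matrix (Fin r) (Fin r) ℝ) : ℝ :=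
  ‖Pneg⁻¹‖ * (‖Pinf - Pneg‖ + ‖P - Pinf‖)

/-- `χ_δ = (λ_min(Δ_δ) λ_min(-P∞⁻))⁻¹`. -/
def chiDelta (A S Pinf Pneg : Matrix (Fin r) (Fin r) ℝ) (δ : ℝ) : ℝ :=
  (lambdaMin (gramian A S Pinf δ) * lambdaMin (-Pneg))⁻¹

end Riccati

end

namespace Riccati

variable {r : ℕ}

/-! ### Quadratic forms of real matrices -/

/-! Write `L = A - P∞ S`, `E_t = exp(t L)`, `Δ_t` for the Gramian and `Y = Q - P∞`. The deviation
from `P∞` solves `Z' = L Z + Z L' - Z S Z`, which integrates explicitly to `Z_t = E_t Y (1 + Δ_t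
Y)⁻¹ E_t'`. By a resolvent identity two solutions differ by `E_t (1 + Y₁ Δ_t)⁻¹ (Q₁ - Q₂) (1 + Δ_t
Y₂)⁻¹ E_t'`. The factors `E_t` give `α² e^{-2βt}`, so only the inverses must be bounded uniformly in
`t`.

The bound comes from `P∞⁻`: with `D = P∞ - P∞⁻`, `D⁻¹` solves the Lyapunov equation of the Gramian,
hence `Δ_t ≤ D⁻¹`. For `y = Δ_t w` this yields `y·Dy ≤ w·y`, so `y·(1 + YΔ_t)w ≥ y·(Q - P∞⁻)y ≥
λ_min(-P∞⁻)|y|²` (`lambdaMin_mul_euclNorm_le`). Both constants follow from this inequality, which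
also shows that the explicit solution never blows up.

The fixed points and the decay rest on a comparison principle for the Lyapunov equation
(`posSemidef_of_lyapunov`), proved by linear algebra and observability. `P∞` is a trace minimiser
among `P ≥ 0` with `Ricc(P) ≤ 0`: a Newton step from it stays in this set and does not raise the
trace, so it is zero. Time reversal gives `P∞⁻`. -/

theorem posSemidef_iff_isSymm {M : Matrix (Fin r) (Fin r) ℝ} :
    M.PosSemidef ↔ M.IsSymm ∧ ∀ v : Fin r → ℝ, 0 ≤ v ⬝ᵥ M *ᵥ v := by
  rw [Matrix.posSemidef_iff_dotProduct_mulVec]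
  simp [Matrix.IsHermitian, Matrix.IsSymm]

theorem posDef_iff_isSymm {M : Matrix (Fin r) (Fin r) ℝ} :
    M.PosDef ↔ M.IsSymm ∧ ∀ v : Fin r → ℝ, v ≠ 0 → 0 < v ⬝ᵥ M *ᵥ v := by
  rw [Matrix.posDef_iff_dotProduct_mulVec]
  simp [Matrix.IsHermitian, Matrix.IsSymm]

theorem posDef_of_posSemidef_of_ker {M : Matrix (Fin r) (Fin r) ℝ} (hM : M.PosSemidef)
    (h : ∀ v : Fin r → ℝ, M *ᵥ v = 0 → v = 0) : M.PosDef := by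
  obtain ⟨hs, hn⟩ := posSemidef_iff_isSymm.1 hM
  refine posDef_iff_isSymm.2 ⟨hs, fun v hv => lt_of_le_of_ne (hn v) fun h0 => hv (h v ?_)⟩
  exact (hM.dotProduct_mulVec_zero_iff v).1 (by simpa using h0.symm)

theorem mulVec_eq_zero_of_quadForm {M : Matrix (Fin r) (Fin r) ℝ} (hM : M.PosSemidef)
    {v : Fin r → ℝ} (h : v ⬝ᵥ M *ᵥ v ≤ 0) : M *ᵥ v = 0 :=
  (hM.dotProduct_mulVec_zero_iff v).1
    (by simpa using le_antisymm h ((posSemidef_iff_isSymm.1 hM).2 v))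

theorem isSymm_of_posSemidef {M : Matrix (Fin r) (Fin r) ℝ} (hM : M.PosSemidef) : Mᵀ = M :=
  (posSemidef_iff_isSymm.1 hM).1

theorem isSymm_of_posDef {M : Matrix (Fin r) (Fin r) ℝ} (hM : M.PosDef) : Mᵀ = M :=
  (posDef_iff_isSymm.1 hM).1

theorem dotProduct_mulVec_eq (M : Matrix (Fin r) (Fin r) ℝ) (u v : Fin r → ℝ) :
    u ⬝ᵥ M *ᵥ v = (Mᵀ *ᵥ u) ⬝ᵥ v := by
  rw [Matrix.dotProduct_mulVec, Matrix.mulVec_transpose]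

theorem eq_zero_of_posSemidef_neg {D : Matrix (Fin r) (Fin r) ℝ} (h1 : D.PosSemidef)
    (h2 : (-D).PosSemidef) : D = 0 := by
  refine Matrix.ext_of_mulVec_single fun i => ?_
  rw [Matrix.zero_mulVec]
  refine mulVec_eq_zero_of_quadForm h1 ?_
  have := (posSemidef_iff_isSymm.1 h2).2 (Pi.single i 1)
  rw [Matrix.neg_mulVec, dotProduct_neg] at this
  linarith

/-- The smallest eigenvalue of a symmetric matrix relative to a positive definite one. -/
theorem exists_min_relative_eigenvalue [NeZero r] {P D : Matrix (Fin r) (Fin r) ℝ}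
    (hP : P.PosDef) (hD : D.IsSymm) :
    ∃ (m : ℝ) (v : Fin r → ℝ), v ≠ 0 ∧ (D - m • P).PosSemidef ∧ (D - m • P) *ᵥ v = 0 := by
  obtain ⟨hPs, hPp⟩ := posDef_iff_isSymm.1 hP
  have hcomp : IsCompact (Metric.sphere (0 : Fin r → ℝ) 1) := isCompact_sphere _ _
  have hne : (Metric.sphere (0 : Fin r → ℝ) 1).Nonempty :=
    NormedSpace.sphere_nonempty.2 zero_le_one
  have hnz : ∀ v ∈ Metric.sphere (0 : Fin r → ℝ) 1, v ≠ 0 := by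
    rintro v hv rfl; simp at hv
  -- The sphere is that of the sup norm; this is harmless because the Rayleigh quotient is
  -- homogeneous of degree zero.
  obtain ⟨v, hv, hmin⟩ := hcomp.exists_isMinOn (f := fun v => (v ⬝ᵥ D *ᵥ v) / (v ⬝ᵥ P *ᵥ v)) hne
    (ContinuousOn.div (by fun_prop) (by fun_prop) fun v hv => (hPp v (hnz v hv)).ne')
  set m := (v ⬝ᵥ D *ᵥ v) / (v ⬝ᵥ P *ᵥ v) with hm
  have hv0 := hnz v hv
  have hpsd : (D - m • P).PosSemidef := by
    refine posSemidef_iff_isSymm.2 ⟨?_, fun w => ?_⟩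
    · simp only [Matrix.IsSymm, Matrix.transpose_sub, Matrix.transpose_smul]
      rw [hD.eq, hPs.eq]
    · by_cases hw : w = 0
      · simp [hw]
      have hw' : 0 < ‖w‖ := norm_pos_iff.2 hw
      have h1 := hmin (a := ‖w‖⁻¹ • w) (by simp [norm_smul, hw'.ne'])
      have h2 := hPp w hw
      simp only [Set.mem_ofPred_eq, Matrix.mulVec_smul, dotProduct_smul, smul_dotProduct,
        smul_eq_mul] at h1
      rw [mul_div_mul_left _ _ (by positivity), mul_div_mul_left _ _ (by positivity), ← hm,
        le_div_iff₀ h2] at h1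
      simp only [Matrix.sub_mulVec, dotProduct_sub, Matrix.smul_mulVec, dotProduct_smul,
        smul_eq_mul]
      linarith
  refine ⟨m, v, hv0, hpsd, mulVec_eq_zero_of_quadForm hpsd ?_⟩
  simp only [Matrix.sub_mulVec, dotProduct_sub, Matrix.smul_mulVec, dotProduct_smul,
        smul_eq_mul]
  rw [hm, div_mul_cancel₀ _ (hPp v hv0).ne', sub_self]

/-! ### Observability -/

/-- The pair `(C, F)` is observable: no nonzero vector is annihilated by all `C F ^ k`. -/
def IsObservable (C F : Matrix (Fin r) (Fin r) ℝ) : Prop :=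
  ∀ v : Fin r → ℝ, (∀ k : ℕ, C *ᵥ (F ^ k *ᵥ v) = 0) → v = 0

/-- The form in which observability is always applied: a set invariant under `F` and contained in
`ker C` contains no nonzero vector. -/
theorem IsObservable.eq_zero_of_invariant {C F : Matrix (Fin r) (Fin r) ℝ}
    (h : IsObservable C F) {p : (Fin r → ℝ) → Prop} (hC : ∀ v, p v → C *ᵥ v = 0)
    (hF : ∀ v, p v → p (F *ᵥ v)) {v : Fin r → ℝ} (hv : p v) : v = 0 := by
  have hk : ∀ k : ℕ, p (F ^ k *ᵥ v) := by
    intro k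
    induction k with
    | zero => simpa using hv
    | succ k ih => rw [pow_succ', ← Matrix.mulVec_mulVec]; exact hF _ ih
  exact h v fun k => hC _ (hk k)

/-- Full row rank means that no nonzero `v` satisfies `v' A^k B = 0` for all `k < r`, and `B B x =
0` forces `|B x|² = 0`. Observability quantifies over all `k`, so Cayley–Hamilton is not needed. -/
theorem IsControllable.isObservable {A B : Matrix (Fin r) (Fin r) ℝ} (hB : B.IsSymm)
    (h : IsControllable A B) : IsObservable (B * B) Aᵀ := by
  intro v hv
  have hv' : ∀ k : ℕ, B *ᵥ (Aᵀ ^ k *ᵥ v) = 0 := by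
    intro k
    have h1 := congrArg (fun w => (Aᵀ ^ k *ᵥ v) ⬝ᵥ w) (hv k)
    simp only [← Matrix.mulVec_mulVec, dotProduct_zero] at h1
    rw [dotProduct_mulVec_eq, hB.eq] at h1
    exact dotProduct_self_eq_zero.1 h1
  unfold IsControllable at h
  set M := Matrix.of fun (i : Fin r) (k : Fin r × Fin r) => (A ^ (k.1 : ℕ) * B) i k.2 with hM
  have hrow : LinearIndependent ℝ M.row := by
    rw [Matrix.rank_eq_finrank_span_row] at h
    exact linearIndependent_iff_card_eq_finrank_span.2 (by simpa [Set.finrank] using h.symm)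
  have hinj := Matrix.vecMul_injective_iff.2 hrow
  apply hinj
  ext ⟨k, j⟩
  have h2 := congrFun (hv' k) j
  rw [Matrix.mulVec_mulVec, ← Matrix.transpose_pow] at h2
  have h3 : B * (A ^ (k : ℕ))ᵀ = (A ^ (k : ℕ) * B)ᵀ := by rw [Matrix.transpose_mul, hB.eq]
  rw [h3, Matrix.mulVec_transpose] at h2
  simpa [Matrix.vecMul, dotProduct, hM] using h2

/-! ### The Lyapunov equation -/

/-- Comparison principle for the Lyapunov equation. -/
theorem posSemidef_of_lyapunov [NeZero r] {L P N D : Matrix (Fin r) (Fin r) ℝ}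
    (hP : P.PosDef) (hLP : L * P + P * Lᵀ = -N) (hN : N.PosSemidef)
    (hobs : IsObservable N Lᵀ) (hD : D.IsSymm) (h : (-(L * D + D * Lᵀ)).PosSemidef) :
    D.PosSemidef := by
  obtain ⟨m, v, hv0, hpsd, hv⟩ := exists_min_relative_eigenvalue hP hD
  by_cases hm : 0 ≤ m
  · have := hpsd.add (hP.posSemidef.smul hm)
    simpa using this
  -- If the minimal relative eigenvalue `m` is negative, `ker (D - m P)` is a nonzero subspace; it
  -- is shown to lie in `ker N` and to be invariant under `Lᵀ`, contradicting observability. On it,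
  -- the sum of two positive semi-definite matrices in `hsum` has zero quadratic form.
  refine absurd (hobs.eq_zero_of_invariant (p := fun w => (D - m • P) *ᵥ w = 0) ?_ ?_ hv) hv0
  all_goals
    intro w hw
    have hsum : (-(L * D + D * Lᵀ) + (-m) • N).PosSemidef := h.add (hN.smul (by linarith))
    have hN' : N = -(L * P + P * Lᵀ) := by rw [hLP, neg_neg]
    have hident : -(L * D + D * Lᵀ) + (-m) • N =
        -(L * (D - m • P) + (D - m • P) * Lᵀ) := by
      rw [hN']
      simp only [mul_sub, sub_mul, Matrix.mul_smul, Matrix.smul_mul]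
      module
    have hq : w ⬝ᵥ (-(L * D + D * Lᵀ) + (-m) • N) *ᵥ w = 0 := by
      rw [hident]
      simp only [Matrix.neg_mulVec, Matrix.add_mulVec, ← Matrix.mulVec_mulVec, hw,
        Matrix.mulVec_zero, zero_add, dotProduct_neg]
      rw [dotProduct_mulVec_eq, isSymm_of_posSemidef hpsd, hw, zero_dotProduct, neg_zero]
  · have h1 := (posSemidef_iff_isSymm.1 h).2 w
    rw [Matrix.add_mulVec, dotProduct_add, Matrix.smul_mulVec, dotProduct_smul, smul_eq_mul] at hq
    exact mulVec_eq_zero_of_quadForm hN (by nlinarith)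
  · have h1 := mulVec_eq_zero_of_quadForm hsum hq.le
    rw [hident] at h1
    simpa [Matrix.neg_mulVec, Matrix.add_mulVec, ← Matrix.mulVec_mulVec, hw] using h1

/-- Comparison applied to `D` and `-D` gives injectivity, and finite dimension turns it into
surjectivity. -/
theorem exists_lyapunov [NeZero r] {L P N : Matrix (Fin r) (Fin r) ℝ}
    (hP : P.PosDef) (hLP : L * P + P * Lᵀ = -N) (hN : N.PosSemidef)
    (hobs : IsObservable N Lᵀ) {C : Matrix (Fin r) (Fin r) ℝ} (hC : C.IsSymm) :
    ∃ D : Matrix (Fin r) (Fin r) ℝ, D.IsSymm ∧ L * D + D * Lᵀ = C := by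
  -- The antisymmetric term `D - Dᵀ` extends the Lyapunov operator to all matrices so that a
  -- symmetric value `T D` forces `D` to be symmetric; dimension counting can then be done on the
  -- full matrix space.
  let T : Matrix (Fin r) (Fin r) ℝ →ₗ[ℝ] Matrix (Fin r) (Fin r) ℝ :=
    { toFun := fun D => L * (D + Dᵀ) + (D + Dᵀ) * Lᵀ + (D - Dᵀ)
      map_add' := fun X Y => by
        simp only [Matrix.transpose_add, mul_add, add_mul]; abel
      map_smul' := fun c X => by
        simp only [Matrix.transpose_smul, mul_add, add_mul, Matrix.mul_smul, Matrix.smul_mul,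
          RingHom.id_apply]
        module }
  have hT : ∀ D, T D = L * (D + Dᵀ) + (D + Dᵀ) * Lᵀ + (D - Dᵀ) := fun D => rfl
  have hanti : ∀ D, (T D)ᵀ = T D → Dᵀ = D := by
    intro D h
    rw [hT] at h
    simp only [Matrix.transpose_add, Matrix.transpose_sub, Matrix.transpose_mul,
      Matrix.transpose_transpose] at h
    have h2 : (2 : ℝ) • Dᵀ = (2 : ℝ) • D := by
      have : (Dᵀ + D) = D + Dᵀ := add_comm _ _
      rw [this, add_comm ((D + Dᵀ) * Lᵀ)] at h
      have h3 := add_left_cancel h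
      rw [two_smul, two_smul]
      have h4 : Dᵀ + Dᵀ = (Dᵀ - D) + (D + Dᵀ) := by abel
      rw [h4, h3]; abel
    exact smul_right_injective _ (two_ne_zero) h2
  have hTs : ∀ D, Dᵀ = D → T D = L * ((2 : ℝ) • D) + ((2 : ℝ) • D) * Lᵀ := by
    intro D h
    rw [hT, h, two_smul, sub_self, add_zero]
  have hinj : Function.Injective T := by
    rw [injective_iff_map_eq_zero]
    intro D hD
    have hs := hanti D (by rw [hD, Matrix.transpose_zero])
    rw [hTs D hs] at hD
    have h1 : ((2 : ℝ) • D).PosSemidef :=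
      posSemidef_of_lyapunov hP hLP hN hobs (by rw [Matrix.IsSymm, Matrix.transpose_smul, hs])
        (by rw [hD, neg_zero]; exact Matrix.PosSemidef.zero)
    have h2 : (-((2 : ℝ) • D)).PosSemidef :=
      posSemidef_of_lyapunov hP hLP hN hobs
        (by rw [Matrix.IsSymm, Matrix.transpose_neg, Matrix.transpose_smul, hs])
        (by rw [Matrix.mul_neg, Matrix.neg_mul, ← neg_add, hD, neg_zero, neg_zero]
            exact Matrix.PosSemidef.zero)
    have h3 := eq_zero_of_posSemidef_neg h1 h2
    simpa using h3
  obtain ⟨D, hD⟩ := LinearMap.injective_iff_surjective.1 hinj C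
  have hs := hanti D (by rw [hD, hC.eq])
  exact ⟨(2 : ℝ) • D, by rw [Matrix.IsSymm, Matrix.transpose_smul, hs], by rw [← hTs D hs, hD]⟩

/-! ### The algebraic Riccati equation -/

/-- Exact second-order Taylor expansion of the drift at `P`; its linear part is the Lyapunov
operator of the closed loop `A - P S`. -/
theorem ricc_add (A R S P D : Matrix (Fin r) (Fin r) ℝ) (hP : P.IsSymm) (hS : S.IsSymm) :
    ricc A R S (P + D) =
      ricc A R S P + ((A - P * S) * D + D * (A - P * S)ᵀ) - D * S * D := by
  simp only [ricc, Matrix.transpose_sub, Matrix.transpose_mul, hP.eq, hS.eq]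
  noncomm_ring

theorem closedLoop_lyapunov (A R S P : Matrix (Fin r) (Fin r) ℝ) (hP : P.IsSymm)
    (hS : S.IsSymm) :
    (A - P * S) * P + P * (A - P * S)ᵀ = -(R + P * S * P - ricc A R S P) := by
  simp only [ricc, Matrix.transpose_sub, Matrix.transpose_mul, hP.eq, hS.eq]
  noncomm_ring

theorem posSemidef_conj {S : Matrix (Fin r) (Fin r) ℝ} (hS : S.PosSemidef)
    {P : Matrix (Fin r) (Fin r) ℝ} (hP : P.IsSymm) : (P * S * P).PosSemidef := by
  have := hS.mul_mul_conjTranspose_same P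
  rwa [Matrix.conjTranspose_eq_transpose_of_trivial, hP.eq] at this

/-- If `N` dominates `R + P S P`, the closed loop pair is observable. -/
theorem isObservable_closedLoop {A R S P N : Matrix (Fin r) (Fin r) ℝ} (hR : R.PosSemidef)
    (hS : S.PosSemidef) (hP : P.IsSymm) (hA : IsObservable R Aᵀ)
    (hN : (N - (R + P * S * P)).PosSemidef) : IsObservable N (A - P * S)ᵀ := by
  have hkey : ∀ w : Fin r → ℝ, N *ᵥ w = 0 → R *ᵥ w = 0 ∧ S *ᵥ (P *ᵥ w) = 0 := by
    intro w hw
    have h1 := (posSemidef_iff_isSymm.1 hN).2 w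
    have h2 := (posSemidef_iff_isSymm.1 hR).2 w
    have h3 := (posSemidef_iff_isSymm.1 hS).2 (P *ᵥ w)
    simp only [Matrix.sub_mulVec, Matrix.add_mulVec, hw, dotProduct_sub, dotProduct_add,
      dotProduct_zero, ← Matrix.mulVec_mulVec] at h1
    rw [dotProduct_mulVec_eq P, hP.eq] at h1
    exact ⟨mulVec_eq_zero_of_quadForm hR (by linarith),
      mulVec_eq_zero_of_quadForm hS (by linarith)⟩
  -- Where `N w = 0` one has `S P w = 0`, so `Aᵀ` and `(A - P S)ᵀ` agree there. The unobservable
  -- subspace of the closed loop is therefore `Aᵀ`-invariant and contained in `ker R`.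
  intro v hv
  refine hA.eq_zero_of_invariant (p := fun w => ∀ k : ℕ, N *ᵥ ((A - P * S)ᵀ ^ k *ᵥ w) = 0)
    (fun w hw => (hkey w (by simpa using hw 0)).1) (fun w hw k => ?_) hv
  have h1 : Aᵀ *ᵥ w = (A - P * S)ᵀ *ᵥ w := by
    rw [Matrix.transpose_sub, Matrix.sub_mulVec, Matrix.transpose_mul, hP.eq,
      isSymm_of_posSemidef hS, ← Matrix.mulVec_mulVec, (hkey w (by simpa using hw 0)).2, sub_zero]
  have h2 := hw (k + 1)
  rw [pow_succ, ← Matrix.mulVec_mulVec] at h2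
  rwa [h1]

/-- After a shift by `μ`, a Lyapunov equation gives `W > 0` with `A'W + WA + 2μW = S`. For `V =
W⁻¹`, `Ricc(cV) = R - 2μc V - c(c-1) V S V`, which is nonpositive for large `c`. -/
theorem exists_posDef_ricc_nonpos [NeZero r] {A R S : Matrix (Fin r) (Fin r) ℝ}
    (hR : R.PosSemidef) (hS : S.PosSemidef) (hAS : IsObservable S A) :
    ∃ P : Matrix (Fin r) (Fin r) ℝ, P.PosDef ∧ (-ricc A R S P).PosSemidef := by
  have hSs := isSymm_of_posSemidef hS
  have hAA : (A + Aᵀ).IsSymm := by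
    rw [Matrix.IsSymm, Matrix.transpose_add, Matrix.transpose_transpose, add_comm]
  obtain ⟨m₀, -, -, hm₀, -⟩ := exists_min_relative_eigenvalue (P := 1) Matrix.PosDef.one hAA
  obtain ⟨μ, hμ, hN⟩ : ∃ μ : ℝ, 0 < μ ∧ (A + Aᵀ + (2 * μ) • 1).PosDef := by
    refine ⟨|m₀| + 1, by positivity, ?_⟩
    have h1 : (A + Aᵀ + (2 * (|m₀| + 1)) • 1 : Matrix (Fin r) (Fin r) ℝ) =
        (m₀ + 2 * (|m₀| + 1)) • 1 + (A + Aᵀ - m₀ • 1) := by module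
    rw [h1]
    exact (Matrix.PosDef.one.smul
      (by have := neg_abs_le m₀; have := abs_nonneg m₀; linarith)).add_posSemidef hm₀
  set L : Matrix (Fin r) (Fin r) ℝ := -(A + μ • 1)ᵀ with hL
  have hLt : Lᵀ = -(A + μ • 1) := by simp [hL]
  have hL1 : L * 1 + 1 * Lᵀ = -(A + Aᵀ + (2 * μ) • 1) := by
    rw [hLt, hL, mul_one, one_mul, Matrix.transpose_add, Matrix.transpose_smul,
      Matrix.transpose_one]
    module
  have hobs : IsObservable (A + Aᵀ + (2 * μ) • 1) Lᵀ := by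
    intro v hv
    by_contra hne
    have h1 := (posDef_iff_isSymm.1 hN).2 v hne
    have h2 := hv 0
    rw [pow_zero, Matrix.one_mulVec] at h2
    rw [h2, dotProduct_zero] at h1
    exact lt_irrefl _ h1
  obtain ⟨W, hWs, hW⟩ := exists_lyapunov (C := -S) Matrix.PosDef.one hL1 hN.posSemidef hobs
    (by rw [Matrix.IsSymm, Matrix.transpose_neg, hSs])
  have hWpsd : W.PosSemidef := posSemidef_of_lyapunov Matrix.PosDef.one hL1 hN.posSemidef hobs hWs
    (by rw [hW, neg_neg]; exact hS)
  have hWA : Aᵀ * W + W * A + (2 * μ) • W = S := by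
    rw [← neg_neg S, ← hW, hLt, hL, Matrix.transpose_add, Matrix.transpose_smul,
      Matrix.transpose_one]
    simp only [neg_mul, mul_neg, add_mul, mul_add, Matrix.smul_mul, Matrix.mul_smul, one_mul,
      mul_one]
    module
  have hWpd : W.PosDef := by
    refine posDef_of_posSemidef_of_ker hWpsd fun v hv => ?_
    have hWS : ∀ w, W *ᵥ w = 0 → S *ᵥ w = 0 := by
      intro w hw
      refine mulVec_eq_zero_of_quadForm hS ?_
      rw [← hWA]
      simp only [Matrix.add_mulVec, Matrix.smul_mulVec, ← Matrix.mulVec_mulVec, hw,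
        Matrix.mulVec_zero, smul_zero, zero_add, add_zero]
      rw [dotProduct_mulVec_eq, hWs.eq, hw, zero_dotProduct]
    refine hAS.eq_zero_of_invariant (p := fun w => W *ᵥ w = 0) hWS (fun w hw => ?_) hv
    have h1 := hWS w hw
    rw [← hWA] at h1
    simpa [Matrix.add_mulVec, Matrix.smul_mulVec, ← Matrix.mulVec_mulVec, hw] using h1
  have hWu : IsUnit W.det := (Matrix.isUnit_iff_isUnit_det _).1 hWpd.isUnit
  have hV : (W⁻¹).PosDef := hWpd.inv
  have hVeq : A * W⁻¹ + W⁻¹ * Aᵀ + (2 * μ) • W⁻¹ = W⁻¹ * S * W⁻¹ := by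
    rw [← hWA]
    simp only [mul_add, add_mul, Matrix.mul_smul, Matrix.smul_mul, mul_assoc]
    rw [Matrix.mul_nonsing_inv _ hWu, mul_one, mul_one, Matrix.nonsing_inv_mul_cancel_left _ _ hWu]
    abel
  obtain ⟨m, -, -, hm, -⟩ := exists_min_relative_eigenvalue (D := -R) hV
    (by rw [Matrix.IsSymm, Matrix.transpose_neg, isSymm_of_posSemidef hR])
  -- Since `-R ≥ m V`, the term `2μc V` absorbs `R` once `2μc + m ≥ 0`; `c ≥ 1` gives the quadratic
  -- term its sign.
  obtain ⟨c, hc1, hcm⟩ : ∃ c : ℝ, 1 ≤ c ∧ 0 ≤ 2 * μ * c + m := by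
    refine ⟨max 1 (-m / (2 * μ)), le_max_left _ _, ?_⟩
    have h1 := le_max_right 1 (-m / (2 * μ))
    rw [div_le_iff₀ (by positivity)] at h1
    linarith
  refine ⟨c • W⁻¹, hV.smul (by linarith), ?_⟩
  have hid : -ricc A R S (c • W⁻¹) = (-R - m • W⁻¹) + (2 * μ * c + m) • W⁻¹ +
      (c * (c - 1)) • (W⁻¹ * S * W⁻¹) := by
    have h2 : A * W⁻¹ + W⁻¹ * Aᵀ = W⁻¹ * S * W⁻¹ - (2 * μ) • W⁻¹ := by rw [← hVeq]; abel
    have h3 : A * (c • W⁻¹) + (c • W⁻¹) * Aᵀ = c • (W⁻¹ * S * W⁻¹ - (2 * μ) • W⁻¹) := by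
      rw [← h2]; simp only [Matrix.mul_smul, Matrix.smul_mul, smul_add]
    rw [ricc, h3]
    simp only [Matrix.mul_smul, Matrix.smul_mul]
    module
  rw [hid]
  exact (hm.add (hV.posSemidef.smul hcm)).add
    ((posSemidef_conj hS (isSymm_of_posDef hV)).smul
      (mul_nonneg (by linarith) (by linarith)))

/-- Testing on `e_i ± e_j` bounds the entry by diagonal entries. This makes trace-bounded sets of
positive semi-definite matrices compact. -/
theorem abs_apply_le_trace {P : Matrix (Fin r) (Fin r) ℝ} (hP : P.PosSemidef) (i j : Fin r) :
    |P i j| ≤ P.trace := by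
  have hd : ∀ k, 0 ≤ P k k := fun k => hP.diag_nonneg
  have hs : P j i = P i j := by
    conv_lhs => rw [← isSymm_of_posSemidef hP]
    rfl
  have h1 := (posSemidef_iff_isSymm.1 hP).2 (Pi.single i 1 + Pi.single j 1)
  have h2 := (posSemidef_iff_isSymm.1 hP).2 (Pi.single i 1 - Pi.single j 1)
  simp [Matrix.mulVec_add, Matrix.mulVec_sub, hs] at h1 h2
  have h3 : ∀ k, P k k ≤ P.trace := fun k =>
    Finset.single_le_sum (f := fun k => P k k) (fun k _ => hd k) (Finset.mem_univ k)
  have := h3 i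
  have := h3 j
  rw [abs_le]
  constructor <;> linarith

theorem isClosed_posSemidef : IsClosed {P : Matrix (Fin r) (Fin r) ℝ | P.PosSemidef} := by
  simp only [posSemidef_iff_isSymm, Set.ofPred_and, Set.ofPred_forall]
  refine IsClosed.inter ?_ (isClosed_iInter fun v => ?_)
  · exact isClosed_eq (Continuous.matrix_transpose continuous_id) continuous_id
  · exact isClosed_le continuous_const
      (Continuous.dotProduct continuous_const (Continuous.matrix_mulVec continuous_id continuous_const))

/-- On `ker P` the quadratic form of `-Ricc(P)` is `-w·Rw`. Being nonnegative, it forces `R w = 0`,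
and then `P Aᵀ w = 0`: the kernel is `Aᵀ`-invariant inside `ker R`, hence zero. -/
theorem posDef_of_ricc_nonpos {A R S P : Matrix (Fin r) (Fin r) ℝ} (hR : R.PosSemidef)
    (hAR : IsObservable R Aᵀ) (hP : P.PosSemidef) (hric : (-ricc A R S P).PosSemidef) :
    P.PosDef := by
  have hPs := isSymm_of_posSemidef hP
  refine posDef_of_posSemidef_of_ker hP fun v hv => ?_
  have hquad : ∀ w, P *ᵥ w = 0 → (-ricc A R S P) *ᵥ w = -(P *ᵥ (Aᵀ *ᵥ w) + R *ᵥ w) := by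
    intro w hw
    simp [ricc, Matrix.sub_mulVec, Matrix.add_mulVec, ← Matrix.mulVec_mulVec, hw]
  have hq : ∀ w, P *ᵥ w = 0 →
      w ⬝ᵥ (-ricc A R S P) *ᵥ w = - (w ⬝ᵥ R *ᵥ w) := by
    intro w hw
    rw [hquad w hw, dotProduct_neg, dotProduct_add, dotProduct_mulVec_eq P, hPs, hw,
      zero_dotProduct, zero_add]
  have hker : ∀ w, P *ᵥ w = 0 → R *ᵥ w = 0 := by
    intro w hw
    have h1 := (posSemidef_iff_isSymm.1 hric).2 w
    rw [hq w hw] at h1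
    exact mulVec_eq_zero_of_quadForm hR (by linarith)
  refine hAR.eq_zero_of_invariant (p := fun w => P *ᵥ w = 0) hker (fun w hw => ?_) hv
  have h1 : (-ricc A R S P) *ᵥ w = 0 := by
    refine mulVec_eq_zero_of_quadForm hric ?_
    rw [hq w hw, hker w hw, dotProduct_zero, neg_zero]
  rw [hquad w hw, hker w hw, add_zero, neg_eq_zero] at h1
  exact h1

theorem existsUnique_isPosFixedPoint [NeZero r] {A R S : Matrix (Fin r) (Fin r) ℝ}
    (hR : R.PosSemidef) (hS : S.PosSemidef) (hAR : IsObservable R Aᵀ)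
    (hAS : IsObservable S A) : ∃! P, IsPosFixedPoint A R S P := by
  have hSs := isSymm_of_posSemidef hS
  -- Uniqueness: expanding `Ricc(Q)` at `P` gives `-(L(P-Q) + (P-Q)L') = (Q-P)S(Q-P) ≥ 0`, so `P ≥
  -- Q`; exchanging the roles gives equality.
  have hcomp : ∀ P Q, IsPosFixedPoint A R S P → IsPosFixedPoint A R S Q →
      (P - Q).PosSemidef := by
    rintro P Q ⟨hP, hPr⟩ ⟨hQ, hQr⟩
    have hPs := isSymm_of_posDef hP
    have hQs := isSymm_of_posDef hQ
    have h1 := closedLoop_lyapunov A R S P hPs hSs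
    rw [hPr, sub_zero] at h1
    refine posSemidef_of_lyapunov hP h1 (hR.add (posSemidef_conj hS hPs))
      (isObservable_closedLoop hR hS hPs hAR (by rw [sub_self]; exact Matrix.PosSemidef.zero))
      (by rw [Matrix.IsSymm, Matrix.transpose_sub, hPs, hQs]) ?_
    have h2 := ricc_add A R S P (Q - P) hPs hSs
    rw [add_sub_cancel, hPr, hQr, zero_add] at h2
    have h3 : -((A - P * S) * (P - Q) + (P - Q) * (A - P * S)ᵀ) = (Q - P) * S * (Q - P) := by
      rw [← sub_eq_zero.1 h2.symm]
      noncomm_ring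
    rw [h3]
    exact posSemidef_conj hS (by rw [Matrix.IsSymm, Matrix.transpose_sub, hPs, hQs])
  obtain ⟨P₀, hP₀, hP₀r⟩ := exists_posDef_ricc_nonpos (A := A) hR hS hAS
  let K : Set (Matrix (Fin r) (Fin r) ℝ) :=
    {P | P.PosSemidef} ∩ {P | (-ricc A R S P).PosSemidef} ∩ {P | P.trace ≤ P₀.trace}
  have hricc : Continuous fun P : Matrix (Fin r) (Fin r) ℝ => -ricc A R S P := by
    unfold ricc; fun_prop
  have htr : Continuous fun P : Matrix (Fin r) (Fin r) ℝ => P.trace :=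
    Continuous.matrix_trace continuous_id
  have hKc : IsClosed K :=
    (isClosed_posSemidef.inter (isClosed_posSemidef.preimage hricc)).inter
      (isClosed_le htr continuous_const)
  have hbox : IsCompact (Set.univ.pi fun _ : Fin r => Set.univ.pi fun _ : Fin r =>
      Set.Icc (-P₀.trace) P₀.trace) :=
    isCompact_univ_pi fun _ => isCompact_univ_pi fun _ => isCompact_Icc
  have hKcomp : IsCompact K := by
    refine IsCompact.of_isClosed_subset hbox hKc fun P hP i _ j _ => ?_
    exact abs_le.1 ((abs_apply_le_trace hP.1.1 i j).trans hP.2)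
  obtain ⟨P, hPK, hmin⟩ := hKcomp.exists_isMinOn (f := fun P => P.trace)
    ⟨P₀, ⟨hP₀.posSemidef, hP₀r⟩, le_refl P₀.trace⟩ htr.continuousOn
  have hPpsd : P.PosSemidef := hPK.1.1
  have hPr : (-ricc A R S P).PosSemidef := hPK.1.2
  have hP := posDef_of_ricc_nonpos hR hAR hPpsd hPr
  have hPs := isSymm_of_posDef hP
  have hlyap := closedLoop_lyapunov A R S P hPs hSs
  set N := R + P * S * P - ricc A R S P with hNdef
  have hRP : (R + P * S * P).PosSemidef := hR.add (posSemidef_conj hS hPs)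
  have hNpsd : N.PosSemidef := by
    rw [hNdef, sub_eq_add_neg]; exact hRP.add hPr
  have hobs : IsObservable N (A - P * S)ᵀ := isObservable_closedLoop hR hS hPs hAR
    (by rw [hNdef]; simpa using hPr)
  -- Newton step at the minimiser `P`. Comparison gives `D ≤ 0` and `P + D ≥ 0`, and only the
  -- quadratic remainder `-D S D` of the drift survives. Minimality of the trace then forces `D =
  -- 0`.
  obtain ⟨D, hDs, hD⟩ := exists_lyapunov (C := -ricc A R S P) hP hlyap hNpsd hobs
    (isSymm_of_posSemidef hPr)
  have hDneg : (-D).PosSemidef :=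
    posSemidef_of_lyapunov hP hlyap hNpsd hobs (by rw [Matrix.IsSymm, Matrix.transpose_neg, hDs.eq])
      (by
        have : -((A - P * S) * -D + -D * (A - P * S)ᵀ) = -ricc A R S P := by
          rw [← hD]; noncomm_ring
        rw [this]; exact hPr)
  have hPD : (P + D).PosSemidef :=
    posSemidef_of_lyapunov hP hlyap hNpsd hobs
      (by rw [Matrix.IsSymm, Matrix.transpose_add, hDs.eq, hPs])
      (by
        have : -((A - P * S) * (P + D) + (P + D) * (A - P * S)ᵀ) = R + P * S * P := by
          have h1 : (A - P * S) * (P + D) + (P + D) * (A - P * S)ᵀ =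
            ((A - P * S) * P + P * (A - P * S)ᵀ) + ((A - P * S) * D + D * (A - P * S)ᵀ) := by
              noncomm_ring
          rw [h1, hlyap, hD, hNdef]; abel
        rw [this]; exact hRP)
  have hPDr : ricc A R S (P + D) = -(D * S * D) := by
    rw [ricc_add A R S P D hPs hSs, hD]; abel
  have htrD : D.trace ≤ 0 := by
    have := hDneg.trace_nonneg
    rw [Matrix.trace_neg] at this; linarith
  have hPDK : P + D ∈ K := by
    refine ⟨⟨hPD, ?_⟩, ?_⟩
    · change (-ricc A R S (P + D)).PosSemidef
      rw [hPDr, neg_neg]; exact posSemidef_conj hS hDs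
    · have : P.trace ≤ P₀.trace := hPK.2
      change (P + D).trace ≤ P₀.trace
      rw [Matrix.trace_add]; linarith
  have hD0 : D = 0 := by
    have h1 : P.trace ≤ (P + D).trace := hmin hPDK
    rw [Matrix.trace_add] at h1
    have h2 : (-D).trace = 0 := by rw [Matrix.trace_neg]; linarith
    have h3 : -D = 0 := by
      ext i j
      have := abs_apply_le_trace hDneg i j
      rw [h2] at this
      simpa using this
    simpa using h3
  have hfix : IsPosFixedPoint A R S P := by
    refine ⟨hP, ?_⟩
    rw [hD0] at hPDr
    simpa using hPDr
  exact ⟨P, hfix, fun Q hQ => sub_eq_zero.1 (eq_zero_of_posSemidef_neg (hcomp Q P hQ hfix)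
    (by rw [neg_sub]; exact hcomp P Q hfix hQ))⟩

/-- Time reversal: negating both `A` and `P` leaves the drift unchanged. -/
theorem isNegFixedPoint_iff {A R S P : Matrix (Fin r) (Fin r) ℝ} :
    IsNegFixedPoint A R S P ↔ IsPosFixedPoint (-A) R S (-P) := by
  unfold IsNegFixedPoint IsPosFixedPoint ricc
  simp

theorem IsObservable.neg {C F : Matrix (Fin r) (Fin r) ℝ} (h : IsObservable C F) :
    IsObservable C (-F) := by
  intro v hv
  refine h v fun k => ?_
  have := hv k
  rcases Nat.even_or_odd k with hk | hk
  · rwa [hk.neg_pow] at this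
  · rw [hk.neg_pow, Matrix.neg_mulVec, Matrix.mulVec_neg, neg_eq_zero] at this
    exact this

theorem existsUnique_isNegFixedPoint [NeZero r] {A R S : Matrix (Fin r) (Fin r) ℝ}
    (hR : R.PosSemidef) (hS : S.PosSemidef) (hAR : IsObservable R Aᵀ)
    (hAS : IsObservable S A) : ∃! P, IsNegFixedPoint A R S P := by
  obtain ⟨P, hP, huniq⟩ := existsUnique_isPosFixedPoint (A := -A) hR hS
    (by rw [Matrix.transpose_neg]; exact hAR.neg) hAS.neg
  refine ⟨-P, isNegFixedPoint_iff.2 (by rwa [neg_neg]), fun Q hQ => ?_⟩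
  rw [← huniq _ (isNegFixedPoint_iff.1 hQ), neg_neg]

/-! ### Euclidean norms -/

/-- The Euclidean norm of a vector. -/
noncomputable def euclNorm (v : Fin r → ℝ) : ℝ := ‖WithLp.toLp 2 v‖

theorem euclNorm_nonneg (v : Fin r → ℝ) : 0 ≤ euclNorm v := norm_nonneg _

theorem euclNorm_sq (v : Fin r → ℝ) : euclNorm v ^ 2 = v ⬝ᵥ v := by
  rw [euclNorm, EuclideanSpace.real_norm_sq_eq]
  simp [dotProduct, sq]

theorem euclNorm_pos {v : Fin r → ℝ} (hv : v ≠ 0) : 0 < euclNorm v := by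
  rw [euclNorm, norm_pos_iff]
  simpa using hv

theorem eq_zero_of_euclNorm_le_zero {v : Fin r → ℝ} (hv : euclNorm v ≤ 0) : v = 0 := by
  by_contra h
  exact absurd (euclNorm_pos h) (not_lt.2 hv)

theorem euclNorm_sub_le (u v : Fin r → ℝ) : euclNorm (u - v) ≤ euclNorm u + euclNorm v := by
  simpa [euclNorm] using norm_sub_le (WithLp.toLp 2 u) (WithLp.toLp 2 v)

theorem dotProduct_le_euclNorm_mul (u v : Fin r → ℝ) : u ⬝ᵥ v ≤ euclNorm u * euclNorm v := by
  have := real_inner_le_norm (WithLp.toLp 2 u) (WithLp.toLp 2 v)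
  rw [EuclideanSpace.inner_toLp_toLp] at this
  simpa [euclNorm, dotProduct_comm] using this

theorem euclNorm_mulVec_le (M : Matrix (Fin r) (Fin r) ℝ) (v : Fin r → ℝ) :
    euclNorm (M *ᵥ v) ≤ ‖M‖ * euclNorm v :=
  Matrix.l2_opNorm_mulVec M (WithLp.toLp 2 v)

theorem norm_le_of_euclNorm {M : Matrix (Fin r) (Fin r) ℝ} {c : ℝ} (hc : 0 ≤ c)
    (h : ∀ v, euclNorm (M *ᵥ v) ≤ c * euclNorm v) : ‖M‖ ≤ c := by
  rw [← Matrix.l2_opNorm_toEuclideanCLM]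
  exact ContinuousLinearMap.opNorm_le_bound _ hc fun x => h x.ofLp

theorem norm_transpose (M : Matrix (Fin r) (Fin r) ℝ) : ‖Mᵀ‖ = ‖M‖ := by
  rw [← Matrix.conjTranspose_eq_transpose_of_trivial, Matrix.l2_opNorm_conjTranspose]

theorem quadForm_le_norm_mul (M : Matrix (Fin r) (Fin r) ℝ) (v : Fin r → ℝ) :
    v ⬝ᵥ M *ᵥ v ≤ ‖M‖ * euclNorm v ^ 2 := by
  refine (dotProduct_le_euclNorm_mul _ _).trans ?_
  have := mul_le_mul_of_nonneg_left (euclNorm_mulVec_le M v) (euclNorm_nonneg v)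
  nlinarith

/-! ### The minimal eigenvalue -/

theorem mem_spectrum_iff {M : Matrix (Fin r) (Fin r) ℝ} {μ : ℝ} :
    μ ∈ spectrum ℝ M ↔ ∃ v : Fin r → ℝ, v ≠ 0 ∧ M *ᵥ v = μ • v := by
  rw [spectrum.mem_iff, Matrix.isUnit_iff_isUnit_det, isUnit_iff_ne_zero, not_not,
    ← Matrix.exists_mulVec_eq_zero_iff]
  refine exists_congr fun v => and_congr_right fun _ => ?_
  rw [Matrix.sub_mulVec, Algebra.algebraMap_eq_smul_one, Matrix.smul_mulVec, Matrix.one_mulVec,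
    sub_eq_zero, eq_comm]

theorem lambdaMin_spec [NeZero r] {M : Matrix (Fin r) (Fin r) ℝ} (hM : M.IsSymm) :
    (∀ v, lambdaMin M * euclNorm v ^ 2 ≤ v ⬝ᵥ M *ᵥ v) ∧
      ∃ v : Fin r → ℝ, v ≠ 0 ∧ M *ᵥ v = lambdaMin M • v := by
  obtain ⟨m, v, hv0, hpsd, hv⟩ := exists_min_relative_eigenvalue (P := 1) Matrix.PosDef.one hM
  have hle : ∀ w, m * euclNorm w ^ 2 ≤ w ⬝ᵥ M *ᵥ w := by
    intro w
    have := (posSemidef_iff_isSymm.1 hpsd).2 w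
    rw [Matrix.sub_mulVec, Matrix.smul_mulVec, Matrix.one_mulVec, dotProduct_sub,
      dotProduct_smul, smul_eq_mul, ← euclNorm_sq] at this
    linarith
  have hv' : M *ᵥ v = m • v := by
    rwa [Matrix.sub_mulVec, Matrix.smul_mulVec, Matrix.one_mulVec, sub_eq_zero] at hv
  have hmem : m ∈ spectrum ℝ M := mem_spectrum_iff.2 ⟨v, hv0, hv'⟩
  have hlb : ∀ μ ∈ spectrum ℝ M, m ≤ μ := by
    intro μ hμ
    obtain ⟨w, hw0, hw⟩ := mem_spectrum_iff.1 hμ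
    have h1 := hle w
    rw [hw, dotProduct_smul, smul_eq_mul, ← euclNorm_sq] at h1
    exact le_of_mul_le_mul_right h1 (pow_pos (euclNorm_pos hw0) 2)
  have hm : lambdaMin M = m := IsLeast.csInf_eq ⟨hmem, hlb⟩
  rw [hm]
  exact ⟨hle, v, hv0, hv'⟩

theorem lambdaMin_pos [NeZero r] {M : Matrix (Fin r) (Fin r) ℝ} (hM : M.PosDef) :
    0 < lambdaMin M := by
  obtain ⟨hs, hp⟩ := posDef_iff_isSymm.1 hM
  obtain ⟨-, v, hv0, hv⟩ := lambdaMin_spec hs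
  have h1 := hp v hv0
  rw [hv, dotProduct_smul, smul_eq_mul, ← euclNorm_sq] at h1
  exact pos_of_mul_pos_left h1 (by positivity)

theorem inv_lambdaMin_le_norm_inv [NeZero r] {M : Matrix (Fin r) (Fin r) ℝ} (hM : M.PosDef) :
    (lambdaMin M)⁻¹ ≤ ‖M⁻¹‖ := by
  obtain ⟨-, v, hv0, hv⟩ := lambdaMin_spec (posDef_iff_isSymm.1 hM).1
  have hl := lambdaMin_pos hM
  have hdet : IsUnit M.det := (Matrix.isUnit_iff_isUnit_det _).1 hM.isUnit
  have h1 : v = lambdaMin M • (M⁻¹ *ᵥ v) := by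
    rw [← Matrix.mulVec_smul, ← hv, Matrix.mulVec_mulVec, Matrix.nonsing_inv_mul _ hdet,
      Matrix.one_mulVec]
  have h2 : euclNorm v = lambdaMin M * euclNorm (M⁻¹ *ᵥ v) := by
    conv_lhs => rw [h1]
    rw [euclNorm, WithLp.toLp_smul, norm_smul, Real.norm_of_nonneg hl.le, euclNorm]
  have h3 := euclNorm_mulVec_le M⁻¹ v
  have hv := euclNorm_pos hv0
  rw [inv_le_iff_one_le_mul₀ hl]
  refine le_of_mul_le_mul_right ?_ hv
  nlinarith

/-! ### Matrix exponentials -/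

theorem hasDerivAt_exp_smul (M : Matrix (Fin r) (Fin r) ℝ) (t : ℝ) :
    HasDerivAt (fun s : ℝ => NormedSpace.exp (s • M)) (NormedSpace.exp (t • M) * M) t :=
  hasDerivAt_exp_smul_const M t

theorem hasDerivAt_exp_smul' (M : Matrix (Fin r) (Fin r) ℝ) (t : ℝ) :
    HasDerivAt (fun s : ℝ => NormedSpace.exp (s • M)) (M * NormedSpace.exp (t • M)) t :=
  hasDerivAt_exp_smul_const' M t

theorem exp_zero_smul (M : Matrix (Fin r) (Fin r) ℝ) :
    NormedSpace.exp ((0 : ℝ) • M) = 1 := by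
  rw [zero_smul, NormedSpace.exp_zero]

theorem hasDerivAt_transpose {f : ℝ → Matrix (Fin r) (Fin r) ℝ}
    {f' : Matrix (Fin r) (Fin r) ℝ} {t : ℝ} (h : HasDerivAt f f' t) :
    HasDerivAt (fun s => (f s)ᵀ) f'ᵀ t :=
  (LinearMap.toContinuousLinearMap
    (Matrix.transposeLinearEquiv (Fin r) (Fin r) ℝ ℝ).toLinearMap).hasFDerivAt.comp_hasDerivAt t h

theorem hasDerivAt_mulVec {f : ℝ → Matrix (Fin r) (Fin r) ℝ}
    {f' : Matrix (Fin r) (Fin r) ℝ} {t : ℝ} (h : HasDerivAt f f' t) (v : Fin r → ℝ) :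
    HasDerivAt (fun s => f s *ᵥ v) (f' *ᵥ v) t := by
  let T : Matrix (Fin r) (Fin r) ℝ →ₗ[ℝ] (Fin r → ℝ) := (Matrix.mulVecBilin ℝ ℝ).flip v
  exact T.toContinuousLinearMap.hasFDerivAt.comp_hasDerivAt t h

theorem hasDerivAt_quadForm {f : ℝ → Matrix (Fin r) (Fin r) ℝ}
    {f' : Matrix (Fin r) (Fin r) ℝ} {t : ℝ} (h : HasDerivAt f f' t) (v : Fin r → ℝ) :
    HasDerivAt (fun s => v ⬝ᵥ f s *ᵥ v) (v ⬝ᵥ f' *ᵥ v) t := by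
  let T : (Fin r → ℝ) →ₗ[ℝ] ℝ := dotProductBilin ℝ ℝ v
  exact T.toContinuousLinearMap.hasFDerivAt.comp_hasDerivAt t (hasDerivAt_mulVec h v)

theorem hasDerivAt_exp_conj (M X : Matrix (Fin r) (Fin r) ℝ) (t : ℝ) :
    HasDerivAt (fun s : ℝ => (NormedSpace.exp (s • M))ᵀ * X * NormedSpace.exp (s • M))
      ((NormedSpace.exp (t • M))ᵀ * (X * M + Mᵀ * X) * NormedSpace.exp (t • M)) t := by
  have h := ((hasDerivAt_transpose (hasDerivAt_exp_smul' M t)).mul_const X).mul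
    (hasDerivAt_exp_smul' M t)
  refine h.congr_deriv ?_
  rw [Matrix.transpose_mul]
  noncomm_ring

/-- `w·Dw` is a Lyapunov function for the transposed flow `w' = Lᵀ w`, with derivative `-|w|² ≤ -κ⁻¹
w·Dw`. Hence `e^{s/κ} w·Dw` is nonincreasing, and square roots give rate `1/(2κ)` and constant
`√(κ/m)`. -/
theorem exists_decay [NeZero r] {L D : Matrix (Fin r) (Fin r) ℝ} (hD : D.PosDef)
    (h : L * D + D * Lᵀ = -1) :
    ∃ α β : ℝ, 0 < α ∧ 0 < β ∧
      ∀ t : ℝ, 0 ≤ t → ‖NormedSpace.exp (t • L)‖ ≤ α * Real.exp (-β * t) := by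
  have hm := lambdaMin_pos hD
  obtain ⟨hlow, -⟩ := lambdaMin_spec (posDef_iff_isSymm.1 hD).1
  set m := lambdaMin D
  set κ := ‖D‖ + 1 with hκ
  have hκ0 : 0 < κ := by positivity
  refine ⟨√(κ / m), 1 / (2 * κ), by positivity, by positivity, fun t ht => ?_⟩
  rw [← norm_transpose]
  refine norm_le_of_euclNorm (by positivity) fun v => ?_
  set G : ℝ → Matrix (Fin r) (Fin r) ℝ := fun s =>
    (NormedSpace.exp (s • Lᵀ))ᵀ * D * NormedSpace.exp (s • Lᵀ) with hG
  set w : ℝ → (Fin r → ℝ) := fun s => NormedSpace.exp (s • Lᵀ) *ᵥ v with hw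
  have hconj : ∀ (X : Matrix (Fin r) (Fin r) ℝ) (s : ℝ),
      v ⬝ᵥ ((NormedSpace.exp (s • Lᵀ))ᵀ * X * NormedSpace.exp (s • Lᵀ)) *ᵥ v =
        w s ⬝ᵥ X *ᵥ w s := by
    intro X s
    rw [← Matrix.mulVec_mulVec, ← Matrix.mulVec_mulVec, dotProduct_mulVec_eq,
      Matrix.transpose_transpose]
  have hder : ∀ s, HasDerivAt (fun s => v ⬝ᵥ G s *ᵥ v) (-euclNorm (w s) ^ 2) s := by
    intro s
    refine (hasDerivAt_quadForm (hasDerivAt_exp_conj Lᵀ D s) v).congr_deriv ?_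
    rw [Matrix.transpose_transpose, add_comm (D * Lᵀ), h, hconj, Matrix.neg_mulVec,
      Matrix.one_mulVec, dotProduct_neg, euclNorm_sq]
  have hder2 : ∀ s, HasDerivAt (fun s => Real.exp (κ⁻¹ * s) * (v ⬝ᵥ G s *ᵥ v))
      (Real.exp (κ⁻¹ * s) * (κ⁻¹ * (v ⬝ᵥ G s *ᵥ v) - euclNorm (w s) ^ 2)) s := by
    intro s
    have h1 := (((hasDerivAt_id s).const_mul κ⁻¹).exp).mul (hder s)
    refine h1.congr_deriv ?_
    simp only [id]
    ring
  have hanti := antitone_of_hasDerivAt_nonpos hder2 (by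
    intro s
    refine mul_nonpos_of_nonneg_of_nonpos (Real.exp_pos _).le ?_
    have h1 := quadForm_le_norm_mul D (w s)
    rw [← hconj] at h1
    have h2 : v ⬝ᵥ G s *ᵥ v ≤ κ * euclNorm (w s) ^ 2 := by
      refine h1.trans ?_
      have := sq_nonneg (euclNorm (w s))
      nlinarith
    rw [sub_nonpos, inv_mul_le_iff₀ hκ0]
    exact h2)
  have h0 := hanti ht
  simp only [mul_zero, Real.exp_zero, one_mul] at h0
  have hw0 : w 0 = v := by simp only [hw, exp_zero_smul, Matrix.one_mulVec]
  have h1 : v ⬝ᵥ G 0 *ᵥ v ≤ κ * euclNorm v ^ 2 := by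
    rw [hG, hconj, hw0]
    refine (quadForm_le_norm_mul D v).trans ?_
    have := sq_nonneg (euclNorm v)
    nlinarith
  have h2 : m * euclNorm (w t) ^ 2 ≤ v ⬝ᵥ G t *ᵥ v := by
    rw [hG, hconj]; exact hlow _
  have h3 : (NormedSpace.exp (t • L))ᵀ *ᵥ v = w t := by
    rw [hw, ← Matrix.exp_transpose, Matrix.transpose_smul]
  rw [h3]
  refine (sq_le_sq₀ (euclNorm_nonneg _) (by have := euclNorm_nonneg v; positivity)).1 ?_
  have hsq : (√(κ / m) * Real.exp (-(1 / (2 * κ)) * t) * euclNorm v) ^ 2 =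
      κ / m * (Real.exp (κ⁻¹ * t))⁻¹ * euclNorm v ^ 2 := by
    rw [mul_pow, mul_pow, Real.sq_sqrt (by positivity), ← Real.exp_nat_mul, ← Real.exp_neg]
    congr 3
    push_cast
    field_simp
  rw [hsq]
  have he := Real.exp_pos (κ⁻¹ * t)
  rw [div_mul_eq_mul_div, div_mul_eq_mul_div, le_div_iff₀ hm, mul_assoc κ, mul_comm _ (euclNorm v ^ 2),
    ← mul_assoc κ, ← div_eq_mul_inv, le_div_iff₀ he]
  nlinarith [mul_le_mul_of_nonneg_left h2 he.le]

theorem exists_isDecayPair [NeZero r] {A R S P : Matrix (Fin r) (Fin r) ℝ}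
    (hR : R.PosSemidef) (hS : S.PosSemidef) (hAR : IsObservable R Aᵀ)
    (hP : IsPosFixedPoint A R S P) : ∃ α β : ℝ, IsDecayPair A S P α β := by
  obtain ⟨hP, hPr⟩ := hP
  have hPs := isSymm_of_posDef hP
  have hlyap := closedLoop_lyapunov A R S P hPs (isSymm_of_posSemidef hS)
  rw [hPr, sub_zero] at hlyap
  have hN : (R + P * S * P).PosSemidef := hR.add (posSemidef_conj hS hPs)
  have hobs : IsObservable (R + P * S * P) (A - P * S)ᵀ := isObservable_closedLoop hR hS hPs hAR
    (by rw [sub_self]; exact Matrix.PosSemidef.zero)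
  obtain ⟨D, hDs, hD⟩ := exists_lyapunov (C := -1) hP hlyap hN hobs
    (by rw [Matrix.IsSymm, Matrix.transpose_neg, Matrix.transpose_one])
  have hDpsd : D.PosSemidef := posSemidef_of_lyapunov hP hlyap hN hobs hDs
    (by rw [hD, neg_neg]; exact Matrix.PosSemidef.one)
  refine exists_decay (posDef_of_posSemidef_of_ker hDpsd fun v hv => ?_) hD
  have h1 := congrArg (fun B => v ⬝ᵥ B *ᵥ v) hD
  simp only [Matrix.add_mulVec, ← Matrix.mulVec_mulVec, hv, Matrix.mulVec_zero, zero_add,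
    Matrix.neg_mulVec, Matrix.one_mulVec, dotProduct_neg] at h1
  rw [dotProduct_mulVec_eq, hDs.eq, hv, zero_dotProduct] at h1
  exact dotProduct_self_eq_zero.1 (by linarith)

/-! ### The observability Gramian -/

theorem expSemigroup_zero (A S P : Matrix (Fin r) (Fin r) ℝ) : expSemigroup A S P 0 = 1 :=
  exp_zero_smul _

theorem continuous_expSemigroup (A S P : Matrix (Fin r) (Fin r) ℝ) :
    Continuous (expSemigroup A S P) :=
  continuous_iff_continuousAt.2 fun t => (hasDerivAt_exp_smul (A - P * S) t).continuousAt

theorem isUnit_expSemigroup (A S P : Matrix (Fin r) (Fin r) ℝ) (t : ℝ) :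
    IsUnit (expSemigroup A S P t) := Matrix.isUnit_exp _

theorem hasDerivAt_gramian (A S P : Matrix (Fin r) (Fin r) ℝ) (t : ℝ) :
    HasDerivAt (gramian A S P) ((expSemigroup A S P t)ᵀ * S * expSemigroup A S P t) t := by
  have hc : Continuous fun s => (expSemigroup A S P s)ᵀ * S * expSemigroup A S P s := by
    have := continuous_expSemigroup A S P
    exact ((this.matrix_transpose).mul continuous_const).mul this
  have : CompleteSpace (Matrix (Fin r) (Fin r) ℝ) := FiniteDimensional.complete ℝ _
  exact intervalIntegral.integral_hasDerivAt_right (hc.intervalIntegrable _ _)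
    (hc.stronglyMeasurableAtFilter _ _) hc.continuousAt

theorem gramian_zero (A S P : Matrix (Fin r) (Fin r) ℝ) : gramian A S P 0 = 0 := by
  rw [gramian, intervalIntegral.integral_same]

/-- Any solution `X` of the Lyapunov equation makes `Δ_s + E_s' X E_s` constant in `s`. For `X ≥ 0`
this bounds the Gramian by `X` uniformly in time. -/
theorem gramian_eq {A S P X : Matrix (Fin r) (Fin r) ℝ}
    (hX : X * (A - P * S) + (A - P * S)ᵀ * X = -S) (t : ℝ) :
    gramian A S P t = X - (expSemigroup A S P t)ᵀ * X * expSemigroup A S P t := by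
  have hder : ∀ s, HasDerivAt (fun s => gramian A S P s +
      (expSemigroup A S P s)ᵀ * X * expSemigroup A S P s) 0 s := by
    intro s
    have h1 := (hasDerivAt_gramian A S P s).add (hasDerivAt_exp_conj (A - P * S) X s)
    refine h1.congr_deriv ?_
    rw [hX]
    simp only [expSemigroup]
    noncomm_ring
  have h := is_const_of_deriv_eq_zero (fun s => (hder s).differentiableAt)
    (fun s => (hder s).deriv) t 0
  simp only [expSemigroup_zero, gramian_zero, Matrix.transpose_one, one_mul, mul_one,
    zero_add] at h
  exact eq_sub_of_add_eq h

theorem isSymm_gramian {A S P X : Matrix (Fin r) (Fin r) ℝ} (hXs : X.IsSymm)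
    (hX : X * (A - P * S) + (A - P * S)ᵀ * X = -S) (t : ℝ) : (gramian A S P t).IsSymm := by
  rw [gramian_eq hX, Matrix.IsSymm, Matrix.transpose_sub, Matrix.transpose_mul,
    Matrix.transpose_mul, Matrix.transpose_transpose, hXs.eq, mul_assoc]

theorem hasDerivAt_quadForm_gramian (A S P : Matrix (Fin r) (Fin r) ℝ) (v : Fin r → ℝ) (t : ℝ) :
    HasDerivAt (fun s => v ⬝ᵥ gramian A S P s *ᵥ v)
      ((expSemigroup A S P t *ᵥ v) ⬝ᵥ S *ᵥ (expSemigroup A S P t *ᵥ v)) t := by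
  refine (hasDerivAt_quadForm (hasDerivAt_gramian A S P t) v).congr_deriv ?_
  rw [← Matrix.mulVec_mulVec, ← Matrix.mulVec_mulVec, dotProduct_mulVec_eq,
    Matrix.transpose_transpose]

theorem monotone_quadForm_gramian (A P : Matrix (Fin r) (Fin r) ℝ)
    {S : Matrix (Fin r) (Fin r) ℝ} (hS : S.PosSemidef) (v : Fin r → ℝ) :
    Monotone fun s => v ⬝ᵥ gramian A S P s *ᵥ v :=
  monotone_of_hasDerivAt_nonneg (hasDerivAt_quadForm_gramian A S P v)
    fun _ => (posSemidef_iff_isSymm.1 hS).2 _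

theorem posSemidef_gramian {A S P X : Matrix (Fin r) (Fin r) ℝ} (hS : S.PosSemidef)
    (hXs : X.IsSymm) (hX : X * (A - P * S) + (A - P * S)ᵀ * X = -S) {t : ℝ} (ht : 0 ≤ t) :
    (gramian A S P t).PosSemidef := by
  refine posSemidef_iff_isSymm.2 ⟨isSymm_gramian hXs hX t, fun v => ?_⟩
  simpa [gramian_zero] using monotone_quadForm_gramian A P hS v ht

theorem posDef_gramian {A S P X : Matrix (Fin r) (Fin r) ℝ} (hS : S.PosSemidef)
    (hAS : IsObservable S A) (hXs : X.IsSymm)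
    (hX : X * (A - P * S) + (A - P * S)ᵀ * X = -S) {t : ℝ} (ht : 0 < t) :
    (gramian A S P t).PosDef := by
  refine posDef_of_posSemidef_of_ker (posSemidef_gramian hS hXs hX ht.le) fun v hv => ?_
  have hzero : ∀ s ∈ Set.Ioo 0 t, v ⬝ᵥ gramian A S P s *ᵥ v = 0 := by
    intro s hs
    have h1 := monotone_quadForm_gramian A P hS v hs.1.le
    have h2 := monotone_quadForm_gramian A P hS v hs.2.le
    simp only [gramian_zero, hv, Matrix.zero_mulVec, dotProduct_zero] at h1 h2
    exact le_antisymm h2 h1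
  have hzero_deriv : ∀ {F : Type} [NormedAddCommGroup F] [NormedSpace ℝ F] {f : ℝ → F} {f' : F}
      {s : ℝ}, s ∈ Set.Ioo 0 t → (∀ s ∈ Set.Ioo 0 t, f s = 0) → HasDerivAt f f' s → f' = 0 := by
    intro F _ _ f f' s hs hf hd
    refine hd.unique ((hasDerivAt_const s (0 : F)).congr_of_eventuallyEq ?_)
    filter_upwards [Ioo_mem_nhds hs.1 hs.2] with y hy using hf y hy
  -- Differentiating `S E_s v = 0` repeatedly on the open interval puts `E_{t/2} v` in the
  -- unobservable subspace of the closed loop. There `A` and `A - P S` agree, and `E_{t/2}` is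
  -- invertible.
  have hker : ∀ k : ℕ, ∀ s ∈ Set.Ioo 0 t,
      (S * (A - P * S) ^ k * expSemigroup A S P s) *ᵥ v = 0 := by
    intro k
    induction k with
    | zero =>
      intro s hs
      have h1 := hzero_deriv hs hzero (hasDerivAt_quadForm_gramian A S P v s)
      have h2 := mulVec_eq_zero_of_quadForm hS h1.le
      simpa [Matrix.mulVec_mulVec] using h2
    | succ k ih =>
      intro s hs
      have h1 := hzero_deriv hs ih (hasDerivAt_mulVec
        ((hasDerivAt_exp_smul' (A - P * S) s).const_mul (S * (A - P * S) ^ k)) v)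
      rw [pow_succ, ← mul_assoc S, mul_assoc]
      rw [← mul_assoc] at h1 ⊢
      exact h1
  set w := expSemigroup A S P (t / 2) *ᵥ v with hw
  have hmid : t / 2 ∈ Set.Ioo 0 t := ⟨by linarith, by linarith⟩
  have hw0 : w = 0 := by
    refine hAS.eq_zero_of_invariant
      (p := fun w => ∀ k : ℕ, S *ᵥ ((A - P * S) ^ k *ᵥ w) = 0)
      (fun w hw => by simpa using hw 0) (fun w hw k => ?_) (v := w) fun k => ?_
    · have h1 : A *ᵥ w = (A - P * S) *ᵥ w := by
        have h0 := hw 0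
        rw [pow_zero, Matrix.one_mulVec] at h0
        rw [Matrix.sub_mulVec, ← Matrix.mulVec_mulVec, h0, Matrix.mulVec_zero, sub_zero]
      have h2 := hw (k + 1)
      rw [pow_succ, ← Matrix.mulVec_mulVec] at h2
      rwa [h1]
    · rw [hw, Matrix.mulVec_mulVec, Matrix.mulVec_mulVec]
      exact hker k _ hmid
  exact Matrix.mulVec_injective_iff_isUnit.2 (isUnit_expSemigroup A S P (t / 2))
    (by rw [Matrix.mulVec_zero, ← hw, hw0])

/-! ### The Riccati flow -/

theorem hasDerivAt_matrix_inv {f : ℝ → Matrix (Fin r) (Fin r) ℝ}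
    {f' : Matrix (Fin r) (Fin r) ℝ} {t : ℝ} (h : HasDerivAt f f' t) (hu : IsUnit (f t)) :
    HasDerivAt (fun s => (f s)⁻¹) (-((f t)⁻¹ * f' * (f t)⁻¹)) t := by
  have : CompleteSpace (Matrix (Fin r) (Fin r) ℝ) := FiniteDimensional.complete ℝ _
  obtain ⟨u, hu⟩ := hu
  have h1 : HasFDerivAt Ring.inverse
      (-ContinuousLinearMap.mulLeftRight ℝ (Matrix (Fin r) (Fin r) ℝ) ↑u⁻¹ ↑u⁻¹) (f t) := by
    rw [← hu]; exact hasFDerivAt_ringInverse u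
  have h2 := h1.comp_hasDerivAt t h
  simp only [Matrix.nonsing_inv_eq_ringInverse]
  refine h2.congr_deriv ?_
  rw [← hu, Ring.inverse_unit]
  simp

/-- The difference solves a linear equation with coefficients bounded on `[0, t]`, so Grönwall
applies. The factorisation `(A - pS)(p - q) + (p - q)(A' - Sq)` needs no symmetry of the solutions.
-/
theorem riccati_unique {A R S : Matrix (Fin r) (Fin r) ℝ}
    {p q : ℝ → Matrix (Fin r) (Fin r) ℝ}
    (hp : ∀ t : ℝ, 0 ≤ t → HasDerivWithinAt p (ricc A R S (p t)) (Set.Ici 0) t)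
    (hq : ∀ t : ℝ, 0 ≤ t → HasDerivWithinAt q (ricc A R S (q t)) (Set.Ici 0) t)
    (h0 : p 0 = q 0) {t : ℝ} (ht : 0 ≤ t) : p t = q t := by
  have hsub : Set.Icc 0 t ⊆ Set.Ici (0 : ℝ) := Set.Icc_subset_Ici_self
  have hpc : ContinuousOn p (Set.Icc 0 t) :=
    fun s hs => (hp s hs.1).continuousWithinAt.mono hsub
  have hqc : ContinuousOn q (Set.Icc 0 t) :=
    fun s hs => (hq s hs.1).continuousWithinAt.mono hsub
  obtain ⟨a, ha⟩ := isCompact_Icc.exists_bound_of_continuousOn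
    ((continuousOn_const (c := A)).sub (hpc.mul (continuousOn_const (c := S))))
  obtain ⟨b, hb⟩ := isCompact_Icc.exists_bound_of_continuousOn
    ((continuousOn_const (c := Aᵀ)).sub ((continuousOn_const (c := S)).mul hqc))
  refine sub_eq_zero.1 (eq_zero_of_abs_deriv_le_mul_abs_self_of_eq_zero_right (a := 0) (b := t)
    (f := fun s => p s - q s) (f' := fun s => ricc A R S (p s) - ricc A R S (q s)) (K := a + b)
    (hpc.sub hqc) (fun s hs => ((hp s hs.1).sub (hq s hs.1)).mono (Set.Ici_subset_Ici.2 hs.1))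
    (sub_eq_zero.2 h0) (fun s hs => ?_) t ⟨ht, le_rfl⟩)
  have hs' := Set.Ico_subset_Icc_self hs
  have h1 : ricc A R S (p s) - ricc A R S (q s) =
      (A - p s * S) * (p s - q s) + (p s - q s) * (Aᵀ - S * q s) := by
    unfold ricc; noncomm_ring
  rw [h1, add_mul]
  refine (norm_add_le _ _).trans (add_le_add ?_ ?_)
  · exact (norm_mul_le _ _).trans (mul_le_mul_of_nonneg_right (ha s hs') (norm_nonneg _))
  · refine (norm_mul_le _ _).trans ?_
    rw [mul_comm]
    exact mul_le_mul_of_nonneg_right (hb s hs') (norm_nonneg _)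

/-- The explicit solution of the Riccati equation started at `Q`. -/
noncomputable def explicitFlow (A S P : Matrix (Fin r) (Fin r) ℝ) (t : ℝ)
    (Q : Matrix (Fin r) (Fin r) ℝ) : Matrix (Fin r) (Fin r) ℝ :=
  P + expSemigroup A S P t * ((Q - P) * (1 + gramian A S P t * (Q - P))⁻¹) *
    (expSemigroup A S P t)ᵀ

theorem explicitFlow_zero (A S P Q : Matrix (Fin r) (Fin r) ℝ) : explicitFlow A S P 0 Q = Q := by
  simp [explicitFlow, expSemigroup_zero, gramian_zero]

/-- Differentiating `E` and `E'` produces the linear terms; the derivative `E' S E` of the Gramian,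
passing through the inverse, produces exactly `-Z S Z`. -/
theorem hasDerivAt_explicitFlow {A R S P Q : Matrix (Fin r) (Fin r) ℝ} (hP : P.IsSymm)
    (hS : S.IsSymm) (hfix : ricc A R S P = 0) {t : ℝ}
    (hu : IsUnit (1 + gramian A S P t * (Q - P))) :
    HasDerivAt (fun s => explicitFlow A S P s Q) (ricc A R S (explicitFlow A S P t Q)) t := by
  have hE := hasDerivAt_exp_smul' (A - P * S) t
  have hU := hasDerivAt_matrix_inv
    (((hasDerivAt_gramian A S P t).mul_const (Q - P)).const_add 1) hu
  have h := ((hE.mul (hU.const_mul (Q - P))).mul (hasDerivAt_transpose hE)).const_add P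
  refine h.congr_deriv ?_
  rw [explicitFlow, ricc_add A R S P _ hP hS, hfix, Matrix.transpose_mul]
  change (_ * expSemigroup A S P t * _ + expSemigroup A S P t * _) * (expSemigroup A S P t)ᵀ +
    expSemigroup A S P t * _ * ((expSemigroup A S P t)ᵀ * _) = _
  noncomm_ring

/-! ### Contraction estimates -/

theorem posDef_sub_fixedPoints {A R S Pinf Pneg : Matrix (Fin r) (Fin r) ℝ}
    (hP : IsPosFixedPoint A R S Pinf) (hN : IsNegFixedPoint A R S Pneg) :
    (Pinf - Pneg).PosDef := by
  rw [sub_eq_add_neg]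
  exact hP.1.add hN.1

/-- Expanding `Ricc(P∞⁻) = 0` at `P∞` gives `L D + D L' = -D S D` for `D = P∞ - P∞⁻`; conjugating by
`D⁻¹` makes the equation linear. -/
theorem inv_sub_fixedPoints_lyapunov {A R S Pinf Pneg : Matrix (Fin r) (Fin r) ℝ}
    (hS : S.IsSymm) (hP : IsPosFixedPoint A R S Pinf) (hN : IsNegFixedPoint A R S Pneg) :
    (Pinf - Pneg)⁻¹ * (A - Pinf * S) + (A - Pinf * S)ᵀ * (Pinf - Pneg)⁻¹ = -S := by
  have hD := posDef_sub_fixedPoints hP hN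
  have hdet : IsUnit (Pinf - Pneg).det := (Matrix.isUnit_iff_isUnit_det _).1 hD.isUnit
  have h1 := ricc_add A R S Pinf (-(Pinf - Pneg)) (isSymm_of_posDef hP.1) hS
  rw [neg_sub, add_sub_cancel, hP.2, hN.2, zero_add] at h1
  have h2 : (A - Pinf * S) * (Pinf - Pneg) + (Pinf - Pneg) * (A - Pinf * S)ᵀ =
      -((Pinf - Pneg) * S * (Pinf - Pneg)) := by
    rw [← sub_eq_zero, ← neg_eq_zero, h1]
    noncomm_ring
  have h3 := congrArg (fun B => (Pinf - Pneg)⁻¹ * B * (Pinf - Pneg)⁻¹) h2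
  simp only [mul_add, add_mul, mul_neg, neg_mul, mul_assoc] at h3
  rwa [Matrix.mul_nonsing_inv _ hdet, mul_one, mul_one,
    Matrix.nonsing_inv_mul_cancel_left _ _ hdet, Matrix.nonsing_inv_mul_cancel_left _ _ hdet] at h3

theorem quadForm_mulVec_le {Δ D : Matrix (Fin r) (Fin r) ℝ} (hΔ : Δ.PosSemidef) (hD : D.PosDef)
    (hle : (D⁻¹ - Δ).PosSemidef) (w : Fin r → ℝ) :
    (Δ *ᵥ w) ⬝ᵥ D *ᵥ (Δ *ᵥ w) ≤ w ⬝ᵥ Δ *ᵥ w := by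
  have hdet : IsUnit D.det := (Matrix.isUnit_iff_isUnit_det _).1 hD.isUnit
  have hDs := isSymm_of_posDef hD
  have hΔs := isSymm_of_posSemidef hΔ
  set y := Δ *ᵥ w with hy
  -- Completing the square gives `w·y - 2 y·Dy + Dy·ΔDy ≥ 0`; the last term is at most `y·Dy`
  -- because `Δ ≤ D⁻¹`.
  have h1 := (posSemidef_iff_isSymm.1 hΔ).2 (w - D *ᵥ y)
  have h2 := (posSemidef_iff_isSymm.1 hle).2 (D *ᵥ y)
  rw [Matrix.sub_mulVec, Matrix.mulVec_mulVec _ D⁻¹, Matrix.nonsing_inv_mul _ hdet,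
    Matrix.one_mulVec, dotProduct_sub, dotProduct_comm _ y] at h2
  rw [Matrix.mulVec_sub, sub_dotProduct, dotProduct_sub, dotProduct_sub, ← hy,
    dotProduct_comm (D *ᵥ y) y, dotProduct_mulVec_eq Δ w (D *ᵥ y), hΔs, ← hy] at h1
  linarith

theorem lambdaMin_mul_euclNorm_le [NeZero r] {Δ Pinf Pneg Q : Matrix (Fin r) (Fin r) ℝ}
    (hΔ : Δ.PosSemidef) (hD : (Pinf - Pneg).PosDef) (hle : ((Pinf - Pneg)⁻¹ - Δ).PosSemidef)
    (hN : (-Pneg).PosDef) (hQ : Q.PosSemidef) (w : Fin r → ℝ) :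
    lambdaMin (-Pneg) * euclNorm (Δ *ᵥ w) ≤ euclNorm ((1 + (Q - Pinf) * Δ) *ᵥ w) := by
  have h1 := quadForm_mulVec_le hΔ hD hle w
  have h2 := (lambdaMin_spec (posDef_iff_isSymm.1 hN).1).1 (Δ *ᵥ w)
  have h3 := (posSemidef_iff_isSymm.1 hQ).2 (Δ *ᵥ w)
  have h4 := dotProduct_le_euclNorm_mul (Δ *ᵥ w) ((1 + (Q - Pinf) * Δ) *ᵥ w)
  rw [Matrix.add_mulVec, Matrix.one_mulVec, ← Matrix.mulVec_mulVec] at h4 ⊢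
  set y := Δ *ᵥ w
  rw [dotProduct_add, dotProduct_comm y w, Matrix.sub_mulVec, dotProduct_sub,
    ← Matrix.sub_mulVec] at h4
  rw [Matrix.sub_mulVec, dotProduct_sub] at h1
  rw [Matrix.neg_mulVec, dotProduct_neg] at h2
  set n := euclNorm (w + (Q - Pinf) *ᵥ y)
  rcases (euclNorm_nonneg y).eq_or_lt with h0 | h0
  · rw [← h0, mul_zero]; exact euclNorm_nonneg _
  · refine le_of_mul_le_mul_left ?_ h0
    nlinarith

theorem isUnit_one_add [NeZero r] {Δ Pinf Pneg Q : Matrix (Fin r) (Fin r) ℝ}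
    (hΔ : Δ.PosSemidef) (hD : (Pinf - Pneg).PosDef) (hle : ((Pinf - Pneg)⁻¹ - Δ).PosSemidef)
    (hN : (-Pneg).PosDef) (hQ : Q.PosSemidef) : IsUnit (1 + (Q - Pinf) * Δ) := by
  rw [Matrix.isUnit_iff_isUnit_det, isUnit_iff_ne_zero]
  intro hdet
  obtain ⟨w, hw0, hw⟩ := Matrix.exists_mulVec_eq_zero_iff.2 hdet
  have h1 := lambdaMin_mul_euclNorm_le hΔ hD hle hN hQ w
  have h2 : Δ *ᵥ w = 0 := by
    refine eq_zero_of_euclNorm_le_zero ?_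
    rw [hw] at h1
    have h3 : euclNorm (0 : Fin r → ℝ) = 0 := by simp [euclNorm]
    rw [h3] at h1
    exact nonpos_of_mul_nonpos_right h1 (lambdaMin_pos hN)
  rw [Matrix.add_mulVec, Matrix.one_mulVec, ← Matrix.mulVec_mulVec, h2, Matrix.mulVec_zero,
    add_zero] at hw
  exact hw0 hw

theorem norm_inv_le {B : Matrix (Fin r) (Fin r) ℝ} (hB : IsUnit B) {c : ℝ} (hc : 0 ≤ c)
    (h : ∀ w, euclNorm w ≤ c * euclNorm (B *ᵥ w)) : ‖B⁻¹‖ ≤ c := by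
  refine norm_le_of_euclNorm hc fun v => ?_
  have := h (B⁻¹ *ᵥ v)
  rwa [Matrix.mulVec_mulVec, Matrix.mul_nonsing_inv _ ((Matrix.isUnit_iff_isUnit_det _).1 hB),
    Matrix.one_mulVec] at this

/-- For `u = (1 + (Q - P∞)Δ)w` write `w = u - (Q - P∞)Δw` and bound `|Δw|` by `‖(P∞⁻)⁻¹‖ |u|`. This
needs no lower bound on `Δ`, hence holds down to `t = 0`. -/
theorem norm_inv_one_add_le_chi [NeZero r] {Δ Pinf Pneg Q : Matrix (Fin r) (Fin r) ℝ}
    (hΔ : Δ.PosSemidef) (hP : Pinf.PosDef) (hle : ((Pinf - Pneg)⁻¹ - Δ).PosSemidef)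
    (hN : (-Pneg).PosDef) (hQ : Q.PosSemidef) :
    ‖(1 + (Q - Pinf) * Δ)⁻¹‖ ≤ chi Pinf Pneg Q := by
  have hD : (Pinf - Pneg).PosDef := by rw [sub_eq_add_neg]; exact hP.add hN
  have hl := lambdaMin_pos hN
  have hinv : (lambdaMin (-Pneg))⁻¹ ≤ ‖Pneg⁻¹‖ := by
    have := inv_lambdaMin_le_norm_inv hN
    have h2 : (-Pneg)⁻¹ = -Pneg⁻¹ := by
      refine Matrix.inv_eq_right_inv ?_
      rw [neg_mul_neg]
      refine Matrix.mul_nonsing_inv _ ?_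
      rw [← Matrix.isUnit_iff_isUnit_det]
      exact (IsUnit.neg_iff _).1 hN.isUnit
    rwa [h2, norm_neg] at this
  -- Absorbs the coefficient `1` of `|u|` into `chi`: `P∞ > 0` gives `λ_min(-P∞⁻) ≤ ‖P∞ - P∞⁻‖`.
  have hone : 1 ≤ ‖Pneg⁻¹‖ * ‖Pinf - Pneg‖ := by
    obtain ⟨-, v, hv0, hv⟩ := lambdaMin_spec (posDef_iff_isSymm.1 hN).1
    have h1 := quadForm_le_norm_mul (Pinf - Pneg) v
    have h2 := (posDef_iff_isSymm.1 hP).2 v hv0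
    rw [sub_eq_add_neg, Matrix.add_mulVec, dotProduct_add, hv, dotProduct_smul, smul_eq_mul,
      ← euclNorm_sq, ← sub_eq_add_neg] at h1
    have h3 : lambdaMin (-Pneg) ≤ ‖Pinf - Pneg‖ :=
      le_of_mul_le_mul_right (by linarith) (pow_pos (euclNorm_pos hv0) 2)
    calc (1 : ℝ) = (lambdaMin (-Pneg))⁻¹ * lambdaMin (-Pneg) := (inv_mul_cancel₀ hl.ne').symm
      _ ≤ _ := mul_le_mul hinv h3 hl.le (norm_nonneg _)
  refine norm_inv_le (isUnit_one_add hΔ hD hle hN hQ) (by unfold chi; positivity) fun w => ?_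
  have h1 := lambdaMin_mul_euclNorm_le hΔ hD hle hN hQ w
  have h2 : w = (1 + (Q - Pinf) * Δ) *ᵥ w - (Q - Pinf) *ᵥ (Δ *ᵥ w) := by
    rw [Matrix.add_mulVec, Matrix.one_mulVec, ← Matrix.mulVec_mulVec, add_sub_cancel_right]
  set u := (1 + (Q - Pinf) * Δ) *ᵥ w
  have hu := euclNorm_nonneg u
  have h3 : euclNorm (Δ *ᵥ w) ≤ ‖Pneg⁻¹‖ * euclNorm u := by
    refine le_trans ?_ (mul_le_mul_of_nonneg_right hinv hu)
    rwa [le_inv_mul_iff₀ hl]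
  calc euclNorm w ≤ euclNorm u + euclNorm ((Q - Pinf) *ᵥ (Δ *ᵥ w)) := by
        conv_lhs => rw [h2]
        exact euclNorm_sub_le _ _
    _ ≤ euclNorm u + ‖Q - Pinf‖ * (‖Pneg⁻¹‖ * euclNorm u) :=
        add_le_add_right ((euclNorm_mulVec_le _ _).trans
          (mul_le_mul_of_nonneg_left h3 (norm_nonneg _))) _
    _ ≤ ‖Pneg⁻¹‖ * ‖Pinf - Pneg‖ * euclNorm u + ‖Q - Pinf‖ * (‖Pneg⁻¹‖ * euclNorm u) :=
        add_le_add_left (le_mul_of_one_le_left hu hone) _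
    _ = chi Pinf Pneg Q * euclNorm u := by unfold chi; ring

/-- Here `Δ ≥ Δ₀ > 0` and Cauchy–Schwarz give `λ_min(Δ₀)|w| ≤ |Δw|`, which is inserted in the basic
inequality. -/
theorem norm_inv_one_add_le_inv [NeZero r] {Δ Δ₀ Pinf Pneg Q : Matrix (Fin r) (Fin r) ℝ}
    (hΔ : Δ.PosSemidef) (hP : Pinf.PosDef) (hle : ((Pinf - Pneg)⁻¹ - Δ).PosSemidef)
    (hN : (-Pneg).PosDef) (hQ : Q.PosSemidef) (hΔ₀ : Δ₀.PosDef)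
    (hmono : ∀ v, v ⬝ᵥ Δ₀ *ᵥ v ≤ v ⬝ᵥ Δ *ᵥ v) :
    ‖(1 + (Q - Pinf) * Δ)⁻¹‖ ≤ (lambdaMin Δ₀ * lambdaMin (-Pneg))⁻¹ := by
  have hD : (Pinf - Pneg).PosDef := by rw [sub_eq_add_neg]; exact hP.add hN
  have hl := lambdaMin_pos hN
  have hl₀ := lambdaMin_pos hΔ₀
  refine norm_inv_le (isUnit_one_add hΔ hD hle hN hQ) (by positivity) fun w => ?_
  have h1 := lambdaMin_mul_euclNorm_le hΔ hD hle hN hQ w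
  have h2 := (lambdaMin_spec (posDef_iff_isSymm.1 hΔ₀).1).1 w
  have h3 := dotProduct_le_euclNorm_mul w (Δ *ᵥ w)
  have h4 := hmono w
  rw [le_inv_mul_iff₀ (by positivity), mul_right_comm]
  refine le_trans ?_ h1
  rw [mul_comm]
  refine mul_le_mul_of_nonneg_left ?_ hl.le
  rcases (euclNorm_nonneg w).eq_or_lt with h0 | h0
  · rw [← h0, mul_zero]; exact euclNorm_nonneg _
  · refine le_of_mul_le_mul_left ?_ h0
    nlinarith

theorem norm_explicitFlow_sub_le {A S P Q₁ Q₂ : Matrix (Fin r) (Fin r) ℝ} {t : ℝ}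
    (hP : P.IsSymm) (hQ₁ : Q₁.IsSymm) (hQ₂ : Q₂.IsSymm) (hΔ : (gramian A S P t).IsSymm)
    (hu₁ : IsUnit (1 + (Q₁ - P) * gramian A S P t))
    (hu₂ : IsUnit (1 + (Q₂ - P) * gramian A S P t)) :
    ‖explicitFlow A S P t Q₁ - explicitFlow A S P t Q₂‖ ≤
      ‖expSemigroup A S P t‖ ^ 2 * ‖(1 + (Q₁ - P) * gramian A S P t)⁻¹‖ *
        ‖(1 + (Q₂ - P) * gramian A S P t)⁻¹‖ * ‖Q₁ - Q₂‖ := by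
  set Δ := gramian A S P t with hΔdef
  have htr : ∀ Q : Matrix (Fin r) (Fin r) ℝ, Q.IsSymm →
      (1 + (Q - P) * Δ)ᵀ = 1 + Δ * (Q - P) := by
    intro Q hQ
    rw [Matrix.transpose_add, Matrix.transpose_one, Matrix.transpose_mul, Matrix.transpose_sub,
      hΔ.eq, hQ.eq, hP.eq]
  have hd₁ : IsUnit (1 + (Q₁ - P) * Δ).det := (Matrix.isUnit_iff_isUnit_det _).1 hu₁
  have hd₂ : IsUnit (1 + (Q₂ - P) * Δ).det := (Matrix.isUnit_iff_isUnit_det _).1 hu₂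
  have hd₁' : IsUnit (1 + Δ * (Q₁ - P)).det := by
    rw [← htr Q₁ hQ₁, Matrix.det_transpose]; exact hd₁
  have hd₂' : IsUnit (1 + Δ * (Q₂ - P)).det := by
    rw [← htr Q₂ hQ₂, Matrix.det_transpose]; exact hd₂
  have hpush : (Q₁ - P) * (1 + Δ * (Q₁ - P))⁻¹ = (1 + (Q₁ - P) * Δ)⁻¹ * (Q₁ - P) := by
    have h1 : (1 + (Q₁ - P) * Δ) * (Q₁ - P) = (Q₁ - P) * (1 + Δ * (Q₁ - P)) := by noncomm_ring
    have h2 := congrArg (fun B => (1 + (Q₁ - P) * Δ)⁻¹ * B * (1 + Δ * (Q₁ - P))⁻¹) h1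
    rw [Matrix.nonsing_inv_mul_cancel_left _ _ hd₁, mul_assoc,
      Matrix.mul_nonsing_inv_cancel_right _ _ hd₁'] at h2
    exact h2
  -- With `Y_i = Q_i - P`, the push-through identity reduces this to `Y₁(1 + ΔY₂) - (1 + Y₁Δ)Y₂ = Y₁
  -- - Y₂`.
  have hdiff : (Q₁ - P) * (1 + Δ * (Q₁ - P))⁻¹ - (Q₂ - P) * (1 + Δ * (Q₂ - P))⁻¹ =
      (1 + (Q₁ - P) * Δ)⁻¹ * (Q₁ - Q₂) * (1 + Δ * (Q₂ - P))⁻¹ := by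
    have h1 : Q₁ - Q₂ = (Q₁ - P) * (1 + Δ * (Q₂ - P)) - (1 + (Q₁ - P) * Δ) * (Q₂ - P) := by
      noncomm_ring
    rw [hpush, h1, mul_sub _ (_ * _) (_ * _), Matrix.nonsing_inv_mul_cancel_left _ _ hd₁,
      sub_mul (_ * (_ * _)), ← mul_assoc,
      Matrix.mul_nonsing_inv_cancel_right _ _ hd₂']
  have hexp : explicitFlow A S P t Q₁ - explicitFlow A S P t Q₂ =
      expSemigroup A S P t * ((1 + (Q₁ - P) * Δ)⁻¹ * (Q₁ - Q₂) * (1 + Δ * (Q₂ - P))⁻¹) *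
        (expSemigroup A S P t)ᵀ := by
    rw [← hdiff, explicitFlow, explicitFlow, ← hΔdef, add_sub_add_left_eq_sub,
      mul_sub (expSemigroup A S P t) (_ * (_)⁻¹), sub_mul (expSemigroup A S P t * _)]
  have hn : ‖(1 + Δ * (Q₂ - P))⁻¹‖ = ‖(1 + (Q₂ - P) * Δ)⁻¹‖ := by
    rw [← htr Q₂ hQ₂, ← Matrix.transpose_nonsing_inv, norm_transpose]
  rw [hexp]
  calc _ ≤ ‖expSemigroup A S P t‖ * (‖(1 + (Q₁ - P) * Δ)⁻¹‖ * ‖Q₁ - Q₂‖ *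
        ‖(1 + Δ * (Q₂ - P))⁻¹‖) * ‖(expSemigroup A S P t)ᵀ‖ := by
        refine (norm_mul_le _ _).trans (mul_le_mul_of_nonneg_right ?_ (norm_nonneg _))
        refine (norm_mul_le _ _).trans (mul_le_mul_of_nonneg_left ?_ (norm_nonneg _))
        refine (norm_mul_le _ _).trans (mul_le_mul_of_nonneg_right ?_ (norm_nonneg _))
        exact norm_mul_le _ _
    _ = _ := by rw [hn, norm_transpose]; ring

end Riccati

/-! ### Assembly of the main theorem -/

theorem mainTheorem11 (r : ℕ) (hr : 1 ≤ r)
    (A R S Rhalf Shalf : Matrix (Fin r) (Fin r) ℝ)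
    (hR : R.PosSemidef) (hS : S.PosSemidef)
    (hRhalf : Rhalf.IsSymm) (hRsq : Rhalf * Rhalf = R)
    (hShalf : Shalf.IsSymm) (hSsq : Shalf * Shalf = S)
    (hAR : Riccati.IsControllable A Rhalf) (hAS : Riccati.IsControllable Aᵀ Shalf) :
    (∃! P, Riccati.IsPosFixedPoint A R S P) ∧
    (∃! P, Riccati.IsNegFixedPoint A R S P) ∧
    (∃ φ, Riccati.IsRiccatiFlow A R S φ) ∧
    ∀ (Pinf Pneg : Matrix (Fin r) (Fin r) ℝ)
      (φ : ℝ → Matrix (Fin r) (Fin r) ℝ → Matrix (Fin r) (Fin r) ℝ),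
      Riccati.IsPosFixedPoint A R S Pinf →
      Riccati.IsNegFixedPoint A R S Pneg →
      Riccati.IsRiccatiFlow A R S φ →
      (∃ α β : ℝ, Riccati.IsDecayPair A S Pinf α β) ∧
      ∀ α β : ℝ, Riccati.IsDecayPair A S Pinf α β →
        ∀ Q₁ Q₂ : Matrix (Fin r) (Fin r) ℝ, Q₁.PosSemidef → Q₂.PosSemidef →
          (∀ δ t : ℝ, 0 < δ → δ ≤ t →
            ‖φ t Q₁ - φ t Q₂‖ ≤
              (α * Riccati.chiDelta A S Pinf Pneg δ) ^ 2 * Real.exp (-2 * β * t) * ‖Q₁ - Q₂‖) ∧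
          (∀ t : ℝ, 0 ≤ t →
            ‖φ t Q₁ - φ t Q₂‖ ≤
              α ^ 2 * Riccati.chi Pinf Pneg Q₁ * Riccati.chi Pinf Pneg Q₂ *
                Real.exp (-2 * β * t) * ‖Q₁ - Q₂‖) := by
  have : NeZero r := ⟨by omega⟩
  have hobsR : Riccati.IsObservable R Aᵀ := hRsq ▸ hAR.isObservable hRhalf
  have hobsS : Riccati.IsObservable S A := by
    have := hAS.isObservable hShalf
    rwa [hSsq, Matrix.transpose_transpose] at this
  have hSs : S.IsSymm := Riccati.isSymm_of_posSemidef hS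
  have hpos := Riccati.existsUnique_isPosFixedPoint hR hS hobsR hobsS
  have hneg := Riccati.existsUnique_isNegFixedPoint hR hS hobsR hobsS
  have hle : ∀ {Pinf Pneg : Matrix (Fin r) (Fin r) ℝ}, Riccati.IsPosFixedPoint A R S Pinf →
      Riccati.IsNegFixedPoint A R S Pneg → ∀ t : ℝ,
      ((Pinf - Pneg)⁻¹ - Riccati.gramian A S Pinf t).PosSemidef := by
    intro Pinf Pneg hP hN t
    rw [Riccati.gramian_eq (Riccati.inv_sub_fixedPoints_lyapunov hSs hP hN), sub_sub_cancel]
    have := (Riccati.posDef_sub_fixedPoints hP hN).inv.posSemidef.conjTranspose_mul_mul_same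
      (Riccati.expSemigroup A S Pinf t)
    rwa [Matrix.conjTranspose_eq_transpose_of_trivial] at this
  have hgram : ∀ {Pinf Pneg : Matrix (Fin r) (Fin r) ℝ}, Riccati.IsPosFixedPoint A R S Pinf →
      Riccati.IsNegFixedPoint A R S Pneg → ∀ t : ℝ, 0 ≤ t →
      (Riccati.gramian A S Pinf t).PosSemidef := fun hP hN t ht =>
    Riccati.posSemidef_gramian hS
      (Riccati.isSymm_of_posDef (Riccati.posDef_sub_fixedPoints hP hN).inv)
      (Riccati.inv_sub_fixedPoints_lyapunov hSs hP hN) ht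
  have hunit : ∀ {Pinf Pneg Q : Matrix (Fin r) (Fin r) ℝ}, Riccati.IsPosFixedPoint A R S Pinf →
      Riccati.IsNegFixedPoint A R S Pneg → Q.PosSemidef → ∀ t : ℝ, 0 ≤ t →
      IsUnit (1 + (Q - Pinf) * Riccati.gramian A S Pinf t) := fun hP hN hQ t ht =>
    Riccati.isUnit_one_add (hgram hP hN t ht) (Riccati.posDef_sub_fixedPoints hP hN)
      (hle hP hN t) hN.1 hQ
  have hflow : ∀ {Pinf Pneg : Matrix (Fin r) (Fin r) ℝ}, Riccati.IsPosFixedPoint A R S Pinf →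
      Riccati.IsNegFixedPoint A R S Pneg →
      Riccati.IsRiccatiFlow A R S (Riccati.explicitFlow A S Pinf) := by
    intro Pinf Pneg hP hN Q hQ
    have hPs : Pinf.IsSymm := Riccati.isSymm_of_posDef hP.1
    refine ⟨Riccati.explicitFlow_zero A S Pinf Q, fun t ht =>
      (Riccati.hasDerivAt_explicitFlow hPs hSs hP.2 ?_).hasDerivWithinAt⟩
    have h1 := hunit hP hN hQ t ht
    rw [← Matrix.isUnit_transpose, Matrix.transpose_add, Matrix.transpose_one,
      Matrix.transpose_mul, Matrix.transpose_sub, hPs.eq, Riccati.isSymm_of_posSemidef hQ,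
      Riccati.isSymm_of_posSemidef (hgram hP hN t ht)] at h1
    exact h1
  refine ⟨hpos, hneg, ?_, ?_⟩
  · obtain ⟨Pinf, hP, -⟩ := hpos
    obtain ⟨Pneg, hN, -⟩ := hneg
    exact ⟨_, hflow hP hN⟩
  intro Pinf Pneg φ hP hN hφ
  refine ⟨Riccati.exists_isDecayPair hR hS hobsR hP, ?_⟩
  rintro α β ⟨hα, -, hdecay⟩ Q₁ Q₂ hQ₁ hQ₂
  -- Uniqueness identifies any given flow with the explicit one, so the estimates need proof only
  -- for the latter.
  have heq : ∀ Q : Matrix (Fin r) (Fin r) ℝ, Q.PosSemidef → ∀ t : ℝ, 0 ≤ t →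
      φ t Q = Riccati.explicitFlow A S Pinf t Q := by
    intro Q hQ t ht
    obtain ⟨h0, h1⟩ := hφ Q hQ
    obtain ⟨h0', h1'⟩ := hflow hP hN Q hQ
    exact Riccati.riccati_unique h1 h1' (h0.trans h0'.symm) ht
  have hbound : ∀ (t a b : ℝ), 0 ≤ t →
      ‖(1 + (Q₁ - Pinf) * Riccati.gramian A S Pinf t)⁻¹‖ ≤ a →
      ‖(1 + (Q₂ - Pinf) * Riccati.gramian A S Pinf t)⁻¹‖ ≤ b →
      ‖φ t Q₁ - φ t Q₂‖ ≤ α ^ 2 * a * b * Real.exp (-2 * β * t) * ‖Q₁ - Q₂‖ := by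
    intro t a b ht ha hb
    rw [heq Q₁ hQ₁ t ht, heq Q₂ hQ₂ t ht]
    refine (Riccati.norm_explicitFlow_sub_le (Riccati.isSymm_of_posDef hP.1)
      (Riccati.isSymm_of_posSemidef hQ₁) (Riccati.isSymm_of_posSemidef hQ₂)
      (Riccati.isSymm_of_posSemidef (hgram hP hN t ht)) (hunit hP hN hQ₁ t ht)
      (hunit hP hN hQ₂ t ht)).trans ?_
    have ha0 := (norm_nonneg _).trans ha
    have hb0 := (norm_nonneg _).trans hb
    have he : ‖Riccati.expSemigroup A S Pinf t‖ ^ 2 ≤ α ^ 2 * Real.exp (-2 * β * t) := by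
      refine (pow_le_pow_left₀ (norm_nonneg _) (hdecay t ht) 2).trans_eq ?_
      rw [mul_pow, ← Real.exp_nat_mul]
      congr 2
      push_cast
      ring
    calc _ ≤ α ^ 2 * Real.exp (-2 * β * t) * a * b * ‖Q₁ - Q₂‖ := by gcongr
      _ = _ := by ring
  refine ⟨fun δ t hδ hδt => ?_, fun t ht => ?_⟩
  · have ht : 0 ≤ t := hδ.le.trans hδt
    have hpd : (Riccati.gramian A S Pinf δ).PosDef := Riccati.posDef_gramian hS hobsS
      (Riccati.isSymm_of_posDef (Riccati.posDef_sub_fixedPoints hP hN).inv)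
      (Riccati.inv_sub_fixedPoints_lyapunov hSs hP hN) hδ
    have hc : ∀ Q : Matrix (Fin r) (Fin r) ℝ, Q.PosSemidef →
        ‖(1 + (Q - Pinf) * Riccati.gramian A S Pinf t)⁻¹‖ ≤
          Riccati.chiDelta A S Pinf Pneg δ := fun Q hQ =>
      Riccati.norm_inv_one_add_le_inv (hgram hP hN t ht) hP.1 (hle hP hN t) hN.1 hQ hpd
        fun v => Riccati.monotone_quadForm_gramian A Pinf hS v hδt
    refine (hbound t _ _ ht (hc Q₁ hQ₁) (hc Q₂ hQ₂)).trans_eq ?_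
    ring
  · exact hbound t _ _ ht
      (Riccati.norm_inv_one_add_le_chi (hgram hP hN t ht) hP.1 (hle hP hN t) hN.1 hQ₁)
      (Riccati.norm_inv_one_add_le_chi (hgram hP hN t ht) hP.1 (hle hP hN t) hN.1 hQ₂)
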